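/- Let $N\ge 2$, let $B_1$ be the open unit ball of $\mathbb R^N$, $s\in(0,1)$ and $p>2$. Let $G(t)=\int_0^t g(\tau)\,d\tau$ $(t\ge 0)$ be a Young function, that is, $g:[0,\infty)\to[0,\infty)$ is right-continuous and non-decreasing, $g(0)=0$, $g(t)>0$ for $t>0$, and $g(t)\to\infty$ as $t\to\infty$. Put $$q^-=\inf_{t>0}\frac{t\,g(t)}{G(t)},\qquad q^+=\sup_{t>0}\frac{t\,g(t)}{G(t)},$$ and assume that $1<q^-\le q^+<\infty$ and that $t\mapsto G(\sqrt t)$ is convex on $[0,\infty)$. With $\mathcal Q=\mathbb R^{2N}\setminus(\mathbb R^N\setminus B_1)^2$ put, for measurable $u:\mathbb R^N\to\mathbb R$, $$\rho(u)=\iint_{\mathcal Q}G\Big(\frac{|u(x)-u(y)|}{|x-y|^s}\Big)\frac{dx\,dy}{|x-y|^N},\qquad [u]=\inf\{\lambda>0:\rho(u/\lambda)\le 1\}.$$ Let $V$ be the space of measurable radial functions $u:\mathbb R^N\to\mathbb R$ (modulo equality a.e.) with $u|_{B_1}\in L^2(B_1)\cap L^p(B_1)$ and $\rho(u)<\infty$,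 with the norm $\|u\|_V=\|u\|_{L^2(B_1)}+[u]+\|u\|_{L^p(B_1)}$. On $V$ let $$\Psi(u)=\rho(u)+\frac12\int_{B_1}|u|^2\,dx,\qquad \Phi(u)=\frac1p\int_{B_1}|u|^p\,dx,$$ let $$K=\{u\in V: u\ge 0,\ u \text{ is radially non-decreasing on } \mathbb R^N \text{ with respect to } r=|x|\},$$ and let $\Psi_K=\Psi$ on $K$, $\Psi_K=+\infty$ on $V\setminus K$, $I_K=\Psi_K-\Phi$. If $2\le q^-\le q^+<p$, then $I_K$ satisfies the Palais–Smale condition in the sense of Szulkin: for every $c\in\mathbb R$, every sequence $(u_n)$ in $V$ with $I_K(u_n)\to c$ for which there are real numbers $\varepsilon_n\to 0$ with $$\langle D\Phi(u_n),u_n-v\rangle+\Psi_K(v)-\Psi_K(u_n)\ge-\varepsilon_n\|u_n-v\|_V\qquad\text{for all } v\in V \text{ and all } n$$ (where $\Psi_K(u_n)<\infty$ is understood) has a subsequence that converges in $V$. -/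

import Mathlib

open MeasureTheory Set Filter Topology
open scoped ENNReal

namespace FracOrlicz

/-! ### Young functions -/

/-- A Young function, given through its density `g`; only the values of `g` on `[0, ∞)` matter. -/
structure YoungFunction where
  /-- the density -/
  g : ℝ → ℝ
  g_zero : g 0 = 0
  g_pos : ∀ t, 0 < t → 0 < g t
  g_mono : MonotoneOn g (Ioi 0)
  g_rightCont : ∀ t, 0 ≤ t → ContinuousWithinAt g (Ici t) t
  g_tendsto : Tendsto g atTop atTop

namespace YoungFunction

variable (Y : YoungFunction)

/-- `G(t) = ∫₀ᵗ g(τ) dτ`. -/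
noncomputable def G (t : ℝ) : ℝ := ∫ τ in (0 : ℝ)..t, Y.g τ

/-- The set of all the quotients `t g(t) / G(t)`, `t > 0`. -/
def quotients : Set ℝ := (fun t => t * Y.g t / Y.G t) '' Ioi 0

/-- `q⁻ = inf_{t > 0} t g(t) / G(t)`. -/
noncomputable def qMinus : ℝ := sInf Y.quotients

/-- `q⁺ = sup_{t > 0} t g(t) / G(t)`; meaningful if the quotients are bounded. -/
noncomputable def qPlus : ℝ := sSup Y.quotients

/-- The growth condition `1 < q⁻ ≤ t g(t) / G(t) ≤ q⁺ < ∞`. -/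
class Growth : Prop where
  one_lt_qMinus : 1 < Y.qMinus
  bddAbove : BddAbove Y.quotients

lemma g_nonneg {t : ℝ} (ht : 0 ≤ t) : 0 ≤ Y.g t := by
  rcases ht.eq_or_lt with rfl | h
  · exact Y.g_zero.ge
  · exact (Y.g_pos t h).le

lemma g_monoOn : MonotoneOn Y.g (Ici 0) := by
  intro a ha b hb hab
  rcases (mem_Ici.1 ha).eq_or_lt with h | h
  · rw [← h, Y.g_zero]; exact Y.g_nonneg hb
  · exact Y.g_mono h (h.trans_le hab) hab

lemma g_intervalIntegrable {a b : ℝ} (ha : 0 ≤ a) (hb : 0 ≤ b) :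
    IntervalIntegrable Y.g volume a b := by
  apply MonotoneOn.intervalIntegrable
  apply Y.g_monoOn.mono
  intro x hx
  exact (le_min ha hb).trans hx.1

lemma G_zero : Y.G 0 = 0 := by simp [G]

lemma G_sub {a b : ℝ} (ha : 0 ≤ a) (hb : 0 ≤ b) : Y.G b - Y.G a = ∫ τ in a..b, Y.g τ :=
  intervalIntegral.integral_interval_sub_left
    (Y.g_intervalIntegrable le_rfl hb) (Y.g_intervalIntegrable le_rfl ha)

lemma G_support {x y : ℝ} (hx : 0 ≤ x) (hy : 0 ≤ y) :
    Y.G x + Y.g x * (y - x) ≤ Y.G y := by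
  rcases le_total x y with h | h
  · have h1 : ∫ _ in x..y, Y.g x ≤ ∫ τ in x..y, Y.g τ := by
      apply intervalIntegral.integral_mono_on h (by simp) (Y.g_intervalIntegrable hx hy)
      intro t ht
      exact Y.g_monoOn hx (hx.trans ht.1) ht.1
    rw [← Y.G_sub hx hy] at h1
    simp only [intervalIntegral.integral_const, smul_eq_mul] at h1
    linarith
  · have h1 : ∫ τ in y..x, Y.g τ ≤ ∫ _ in y..x, Y.g x := by
      apply intervalIntegral.integral_mono_on h (Y.g_intervalIntegrable hy hx) (by simp)
      intro t ht
      exact Y.g_monoOn (hy.trans ht.1) hx ht.2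
    rw [← Y.G_sub hy hx] at h1
    simp only [intervalIntegral.integral_const, smul_eq_mul] at h1
    linarith

lemma G_nonneg {t : ℝ} (ht : 0 ≤ t) : 0 ≤ Y.G t := by
  have := Y.G_support le_rfl ht
  simpa [Y.G_zero, Y.g_zero] using this

lemma G_mono {a b : ℝ} (ha : 0 ≤ a) (h : a ≤ b) : Y.G a ≤ Y.G b := by
  have h1 := Y.G_support ha (ha.trans h)
  have h2 := mul_nonneg (Y.g_nonneg ha) (sub_nonneg.2 h)
  linarith

lemma G_pos {t : ℝ} (ht : 0 < t) : 0 < Y.G t := by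
  have h1 := Y.G_support (x := t / 2) (y := t) (by positivity) ht.le
  have h2 := Y.g_pos (t / 2) (by positivity)
  have h3 := Y.G_nonneg (t := t / 2) (by positivity)
  nlinarith

lemma G_convex {a b α β : ℝ} (ha : 0 ≤ a) (hb : 0 ≤ b) (hα : 0 ≤ α) (hβ : 0 ≤ β)
    (h : α + β = 1) : Y.G (α * a + β * b) ≤ α * Y.G a + β * Y.G b := by
  have hm : 0 ≤ α * a + β * b := by positivity
  have h1 := mul_le_mul_of_nonneg_left (Y.G_support hm ha) hα
  have h2 := mul_le_mul_of_nonneg_left (Y.G_support hm hb) hβ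
  have h3 : β = 1 - α := by linarith
  subst h3
  nlinarith

lemma measurable_G_max : Measurable (fun t : ℝ => Y.G (max t 0)) := by
  apply Monotone.measurable
  intro a b hab
  exact Y.G_mono (le_max_right _ _) (max_le_max_right _ hab)

lemma exists_doubling [hY : Y.Growth] {c : ℝ} (hc : 0 ≤ c) :
    ∃ C : ℝ, 0 ≤ C ∧ ∀ t, 0 ≤ t → Y.G (c * t) ≤ C * Y.G t := by
  obtain ⟨q', hq'⟩ := hY.bddAbove
  set q := max q' 1
  have hq1 : 1 ≤ q := le_max_right _ _
  have hq : ∀ t, 0 < t → t * Y.g t ≤ q * Y.G t := by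
    intro t ht
    have := (hq' ⟨t, ht, rfl⟩).trans (le_max_left q' 1)
    exact (div_le_iff₀ (Y.G_pos ht)).1 this
  set h := 1 / (2 * q)
  have hh : 0 < h := by positivity
  have hqh : q * h = 1 / 2 := by simp only [h]; field_simp
  have step : ∀ t, 0 ≤ t → Y.G ((1 + h) * t) ≤ 2 * Y.G t := by
    intro t ht
    rcases ht.eq_or_lt with rfl | ht
    · simp [Y.G_zero]
    have hy : 0 < (1 + h) * t := by positivity
    have h1 := Y.G_support hy.le ht.le
    have h2 := hq _ hy
    have h3 := mul_le_mul_of_nonneg_left h2 hh.le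
    have h4 : Y.g ((1 + h) * t) * (t * h) ≤ h * ((1 + h) * t * Y.g ((1 + h) * t)) := by
      have := mul_nonneg (mul_nonneg hh.le hh.le) (mul_nonneg ht.le (Y.g_nonneg hy.le))
      nlinarith
    have h5 : h * (q * Y.G ((1 + h) * t)) = 1 / 2 * Y.G ((1 + h) * t) := by
      rw [← hqh]; ring
    nlinarith
  have iter : ∀ n : ℕ, ∀ t, 0 ≤ t → Y.G ((1 + h) ^ n * t) ≤ 2 ^ n * Y.G t := by
    intro n
    induction n with
    | zero => intro t _; simp
    | succ n ih =>
      intro t ht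
      have e : (1 + h) ^ (n + 1) * t = (1 + h) * ((1 + h) ^ n * t) := by ring
      rw [e]
      refine (step _ (by positivity)).trans ?_
      have := ih t ht
      rw [pow_succ]
      linarith
  obtain ⟨n, hn⟩ := pow_unbounded_of_one_lt c (show 1 < 1 + h by linarith)
  refine ⟨2 ^ n, by positivity, fun t ht => ?_⟩
  refine (Y.G_mono (mul_nonneg hc ht) ?_).trans (iter n t ht)
  exact mul_le_mul_of_nonneg_right hn.le ht

end YoungFunction

/-! ### The modular and the Luxemburg seminorm on `B₁` -/

/-- `ℝᴺ` with its Euclidean norm. -/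
abbrev E (N : ℕ) : Type := EuclideanSpace ℝ (Fin N)

/-- The open unit ball `B₁` of `ℝᴺ`. -/
def B₁ (N : ℕ) : Set (E N) := Metric.ball 0 1

/-- `𝒬 = ℝ²ᴺ ∖ (B₁ᶜ)²`. -/
def Q (N : ℕ) : Set (E N × E N) := ((B₁ N)ᶜ ×ˢ (B₁ N)ᶜ)ᶜ

/-- `|u(x) - u(y)| / |x - y|ˢ`. -/
noncomputable def holderQuot {N : ℕ} (s : ℝ) (u : E N → ℝ) (z : E N × E N) : ℝ :=
  |u z.1 - u z.2| / ‖z.1 - z.2‖ ^ s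

/-- The modular `∬_𝒬 G(|u(x) - u(y)| / |x - y|ˢ) dx dy / |x - y|ᴺ`, with values in `[0, ∞]`. -/
noncomputable def modular {N : ℕ} (s : ℝ) (Y : YoungFunction) (u : E N → ℝ) : ℝ≥0∞ :=
  ∫⁻ z in Q N, ENNReal.ofReal (Y.G (holderQuot s u z) / ‖z.1 - z.2‖ ^ N)

/-- The Luxemburg seminorm: the infimum of all `l > 0` with `modular (u / l) ≤ 1`. -/
noncomputable def luxemburg {N : ℕ} (s : ℝ) (Y : YoungFunction) (u : E N → ℝ) : ℝ :=
  sInf {l : ℝ | 0 < l ∧ modular s Y (fun x => u x / l) ≤ 1}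

section Aux

variable {N : ℕ} {s : ℝ} {Y : YoungFunction} {u v : E N → ℝ}

lemma holderQuot_nonneg (z : E N × E N) : 0 ≤ holderQuot s u z := by
  unfold holderQuot; positivity

lemma modular_congr (h : u =ᵐ[volume] v) : modular s Y u = modular s Y v := by
  apply lintegral_congr_ae
  apply ae_restrict_of_ae
  have h1 : ∀ᵐ z : E N × E N ∂(volume : Measure (E N)).prod volume, u z.1 = v z.1 :=
    Measure.quasiMeasurePreserving_fst.ae h
  have h2 : ∀ᵐ z : E N × E N ∂(volume : Measure (E N)).prod volume, u z.2 = v z.2 :=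
    Measure.quasiMeasurePreserving_snd.ae h
  filter_upwards [h1, h2] with z hz1 hz2
  simp only [holderQuot, hz1, hz2]

lemma luxemburg_congr (h : u =ᵐ[volume] v) : luxemburg s Y u = luxemburg s Y v := by
  unfold luxemburg
  congr 1
  ext l
  have : modular s Y (fun x => u x / l) = modular s Y (fun x => v x / l) := by
    apply modular_congr
    filter_upwards [h] with x hx
    rw [hx]
  simp only [Set.mem_ofPred_eq, this]

lemma measurable_integrand (hu : Measurable u) : Measurable (fun z : E N × E N =>
    ENNReal.ofReal (Y.G (holderQuot s u z) / ‖z.1 - z.2‖ ^ N)) := by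
  have h1 : Measurable (holderQuot s u) := by
    unfold holderQuot
    fun_prop
  have h2 : Measurable (fun z => Y.G (holderQuot s u z)) := by
    have := Y.measurable_G_max.comp h1
    convert this using 2 with z
    simp [max_eq_left (holderQuot_nonneg z)]
  fun_prop

lemma modular_convex (hu : Measurable u) {α β : ℝ} (hα : 0 ≤ α) (hβ : 0 ≤ β) (h : α + β = 1) :
    modular s Y (fun x => α * u x + β * v x) ≤
      ENNReal.ofReal α * modular s Y u + ENNReal.ofReal β * modular s Y v := by
  unfold modular
  rw [← lintegral_const_mul' _ _ ENNReal.ofReal_ne_top,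
    ← lintegral_const_mul' _ _ ENNReal.ofReal_ne_top,
    ← lintegral_add_left ((measurable_integrand hu).const_mul _)]
  refine lintegral_mono fun z => ?_
  have hu0 := holderQuot_nonneg (s := s) (u := u) z
  have hv0 := holderQuot_nonneg (s := s) (u := v) z
  have hle : holderQuot s (fun x => α * u x + β * v x) z ≤
      α * holderQuot s u z + β * holderQuot s v z := by
    unfold holderQuot
    rw [← mul_div_assoc, ← mul_div_assoc, ← add_div]
    apply div_le_div_of_nonneg_right _ (by positivity)
    have e : α * u z.1 + β * v z.1 - (α * u z.2 + β * v z.2)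
        = α * (u z.1 - u z.2) + β * (v z.1 - v z.2) := by ring
    rw [e]
    refine (abs_add_le _ _).trans ?_
    rw [abs_mul, abs_mul, abs_of_nonneg hα, abs_of_nonneg hβ]
  have hG := (Y.G_mono (holderQuot_nonneg z) hle).trans (Y.G_convex hu0 hv0 hα hβ h)
  beta_reduce
  rw [← ENNReal.ofReal_mul hα, ← ENNReal.ofReal_mul hβ, ← ENNReal.ofReal_add
    (mul_nonneg hα (div_nonneg (Y.G_nonneg hu0) (by positivity)))
    (mul_nonneg hβ (div_nonneg (Y.G_nonneg hv0) (by positivity)))]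
  apply ENNReal.ofReal_le_ofReal
  rw [← mul_div_assoc, ← mul_div_assoc, ← add_div]
  exact div_le_div_of_nonneg_right hG (by positivity)

lemma holderQuot_mul (c : ℝ) (z : E N × E N) :
    holderQuot s (fun x => c * u x) z = |c| * holderQuot s u z := by
  unfold holderQuot
  rw [← mul_sub, abs_mul, mul_div_assoc]

lemma modular_abs (c : ℝ) :
    modular s Y (fun x => c * u x) = modular s Y (fun x => |c| * u x) := by
  unfold modular
  simp only [holderQuot_mul, abs_abs]

lemma modular_zero : modular s Y (fun _ : E N => (0 : ℝ)) = 0 := by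
  simp [modular, holderQuot, Y.G_zero]

lemma modular_shrink {c : ℝ} (h0 : 0 ≤ c) (h1 : c ≤ 1) :
    modular s Y (fun x => c * u x) ≤ ENNReal.ofReal c * modular s Y u := by
  have := modular_convex (s := s) (Y := Y) (u := fun _ : E N => (0 : ℝ)) (v := u)
    measurable_const (sub_nonneg.2 h1) h0 (by ring)
  simpa [modular_zero] using this

lemma modular_mul_lt_top [Y.Growth] (c : ℝ) (hu : modular s Y u < ∞) :
    modular s Y (fun x => c * u x) < ∞ := by
  obtain ⟨C, hC, hC'⟩ := Y.exists_doubling (abs_nonneg c)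
  have : modular s Y (fun x => c * u x) ≤ ENNReal.ofReal C * modular s Y u := by
    unfold modular
    rw [← lintegral_const_mul' _ _ ENNReal.ofReal_ne_top]
    refine lintegral_mono fun z => ?_
    beta_reduce
    rw [← ENNReal.ofReal_mul hC, holderQuot_mul]
    apply ENNReal.ofReal_le_ofReal
    rw [← mul_div_assoc]
    apply div_le_div_of_nonneg_right _ (by positivity)
    exact hC' _ (holderQuot_nonneg z)
  exact this.trans_lt (ENNReal.mul_lt_top ENNReal.ofReal_lt_top hu)

lemma modular_add_lt_top [Y.Growth] (hm : Measurable u) (hu : modular s Y u < ∞)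
    (hv : modular s Y v < ∞) : modular s Y (fun x => u x + v x) < ∞ := by
  have h := modular_convex (s := s) (Y := Y) (u := fun x => 2 * u x) (v := fun x => 2 * v x)
    (α := 1 / 2) (β := 1 / 2) (hm.const_mul 2) (by norm_num) (by norm_num) (by norm_num)
  have e : (fun x => 1 / 2 * (2 * u x) + 1 / 2 * (2 * v x)) = fun x => u x + v x := by
    ext x; ring
  rw [e] at h
  exact h.trans_lt (ENNReal.add_lt_top.2
    ⟨ENNReal.mul_lt_top ENNReal.ofReal_lt_top (modular_mul_lt_top 2 hu),
      ENNReal.mul_lt_top ENNReal.ofReal_lt_top (modular_mul_lt_top 2 hv)⟩)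

lemma luxemburg_nonneg : 0 ≤ luxemburg s Y u :=
  Real.sInf_nonneg fun _ h => h.1.le

lemma luxemburg_bddBelow :
    BddBelow {l : ℝ | 0 < l ∧ modular s Y (fun x => u x / l) ≤ 1} :=
  ⟨0, fun _ h => h.1.le⟩

lemma luxemburg_nonempty (hu : modular s Y u < ∞) :
    {l : ℝ | 0 < l ∧ modular s Y (fun x => u x / l) ≤ 1}.Nonempty := by
  set M := (modular s Y u).toReal
  have hM : 0 ≤ M := ENNReal.toReal_nonneg
  refine ⟨M + 1, by positivity, ?_⟩
  have e : (fun x => u x / (M + 1)) = fun x => (M + 1)⁻¹ * u x := by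
    ext x; rw [div_eq_inv_mul]
  rw [e]
  refine (modular_shrink (by positivity) (inv_le_one_of_one_le₀ (by linarith))).trans ?_
  rw [← ENNReal.ofReal_toReal hu.ne, ← ENNReal.ofReal_mul (by positivity)]
  rw [← ENNReal.ofReal_one]
  apply ENNReal.ofReal_le_ofReal
  rw [inv_mul_le_iff₀ (by positivity)]
  change M ≤ _
  linarith

lemma luxemburg_add_le (hm : Measurable u) (hu : modular s Y u < ∞) (hv : modular s Y v < ∞) :
    luxemburg s Y (fun x => u x + v x) ≤ luxemburg s Y u + luxemburg s Y v := by
  apply le_of_forall_pos_le_add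
  intro ε hε
  obtain ⟨a, ⟨ha0, ha⟩, ha'⟩ := exists_lt_of_csInf_lt (luxemburg_nonempty hu)
    (show sInf _ < luxemburg s Y u + ε / 2 by unfold luxemburg; linarith)
  obtain ⟨b, ⟨hb0, hb⟩, hb'⟩ := exists_lt_of_csInf_lt (luxemburg_nonempty hv)
    (show sInf _ < luxemburg s Y v + ε / 2 by unfold luxemburg; linarith)
  have key : luxemburg s Y (fun x => u x + v x) ≤ a + b := by
    apply csInf_le luxemburg_bddBelow
    refine ⟨by positivity, ?_⟩
    have h := modular_convex (s := s) (Y := Y) (u := fun x => u x / a) (v := fun x => v x / b)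
      (α := a / (a + b)) (β := b / (a + b)) (hm.div_const a) (by positivity) (by positivity)
      (by field_simp)
    have e : (fun x => a / (a + b) * (u x / a) + b / (a + b) * (v x / b))
        = fun x => (u x + v x) / (a + b) := by
      ext x; field_simp
    rw [e] at h
    refine h.trans ?_
    calc _ ≤ ENNReal.ofReal (a / (a + b)) * 1 + ENNReal.ofReal (b / (a + b)) * 1 := by gcongr
      _ = 1 := by
        rw [mul_one, mul_one, ← ENNReal.ofReal_add (by positivity) (by positivity),
          ← ENNReal.ofReal_one]
        congr 1
        field_simp
  linarith

lemma luxemburg_smul_le (hu : modular s Y u < ∞) {c : ℝ} (hc : c ≠ 0) :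
    luxemburg s Y (fun x => c * u x) ≤ |c| * luxemburg s Y u := by
  have hc' : 0 < |c| := abs_pos.2 hc
  rw [← div_le_iff₀' hc']
  apply le_csInf (luxemburg_nonempty hu)
  rintro l ⟨hl, hl1⟩
  rw [div_le_iff₀' hc']
  apply csInf_le luxemburg_bddBelow
  refine ⟨by positivity, ?_⟩
  have e : (fun x => c * u x / (|c| * l)) = fun x => (c / |c|) * (u x / l) := by
    ext x; field_simp
  rw [e, modular_abs, abs_div, abs_abs, div_self hc'.ne']
  simpa using hl1

lemma luxemburg_zero : luxemburg s Y (fun _ : E N => (0 : ℝ)) = 0 := by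
  apply le_antisymm _ luxemburg_nonneg
  apply le_of_forall_pos_le_add
  intro ε hε
  rw [zero_add]
  apply csInf_le luxemburg_bddBelow
  refine ⟨hε, ?_⟩
  simp [modular_zero]

lemma luxemburg_smul [Y.Growth] (hu : modular s Y u < ∞) (c : ℝ) :
    luxemburg s Y (fun x => c * u x) = |c| * luxemburg s Y u := by
  rcases eq_or_ne c 0 with rfl | hc
  · simp [luxemburg_zero]
  apply le_antisymm (luxemburg_smul_le hu hc)
  have h := luxemburg_smul_le (u := fun x => c * u x) (modular_mul_lt_top c hu) (inv_ne_zero hc)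
  simp only [inv_mul_cancel_left₀ hc] at h
  rw [abs_inv] at h
  rwa [← le_inv_mul_iff₀ (abs_pos.2 hc)]

lemma modular_eq_zero (hu : modular s Y u < ∞) (h : luxemburg s Y u = 0) :
    modular s Y u = 0 := by
  have : ∀ ε : NNReal, 0 < ε → modular s Y u ≤ 0 + (ε : ℝ≥0∞) := by
    intro ε hε
    obtain ⟨l, ⟨hl0, hl⟩, hl'⟩ := exists_lt_of_csInf_lt (luxemburg_nonempty hu)
      (show sInf _ < min (ε : ℝ) 1 by
        change luxemburg s Y u < _
        rw [h]; exact lt_min (by exact_mod_cast hε) one_pos)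
    have h1 := modular_shrink (s := s) (Y := Y) (u := fun x => u x / l) hl0.le
      (hl'.le.trans (min_le_right _ _))
    simp only [mul_div_cancel₀ _ hl0.ne'] at h1
    have h2 : ENNReal.ofReal l ≤ ε := by
      rw [ENNReal.ofReal_le_iff_le_toReal ENNReal.coe_ne_top]
      exact hl'.le.trans (min_le_left _ _)
    rw [zero_add]
    calc _ ≤ _ := h1
      _ ≤ ε * 1 := by gcongr
      _ = ε := mul_one _
  exact le_antisymm (ENNReal.le_of_forall_pos_le_add fun ε hε _ => this ε hε) bot_le

lemma ae_zero_of_modular (hm : Measurable u) (hmod : modular s Y u = 0)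
    (h : u =ᵐ[volume.restrict (B₁ N)] 0) : u =ᵐ[volume] 0 := by
  have hQ : MeasurableSet (Q N) :=
    (Metric.isOpen_ball.measurableSet.compl.prod Metric.isOpen_ball.measurableSet.compl).compl
  have h1 := (lintegral_eq_zero_iff (measurable_integrand hm)).1 hmod
  rw [Filter.EventuallyEq, ae_restrict_iff' hQ] at h1
  have h2 := Measure.ae_ae_of_ae_prod (μ := (volume : Measure (E N))) (ν := volume) h1
  rw [Filter.EventuallyEq, ae_restrict_iff' (show MeasurableSet (B₁ N) from Metric.isOpen_ball.measurableSet)] at h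
  have hpos : (volume : Measure (E N)) (B₁ N) ≠ 0 :=
    (Metric.isOpen_ball.measure_pos volume ⟨0, by simp⟩).ne'
  obtain ⟨x, hxB, hx0, hx⟩ : ∃ x ∈ B₁ N, u x = 0 ∧ ∀ᵐ y ∂(volume : Measure (E N)), (x, y) ∈ Q N →
      ENNReal.ofReal (Y.G (holderQuot s u (x, y)) / ‖x - y‖ ^ N) = 0 := by
    by_contra hcon
    apply hpos
    have : ∀ᵐ x ∂(volume : Measure (E N)), x ∉ B₁ N := by
      filter_upwards [h, h2] with x hxa hxb hxB
      exact hcon ⟨x, hxB, hxa hxB, hxb⟩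
    exact measure_eq_zero_iff_ae_notMem.2 this
  filter_upwards [hx] with y hy
  have hy' := hy (by simp [Q, hxB])
  by_contra hne
  have hxy : x ≠ y := by
    rintro rfl; exact hne hx0
  have hn : 0 < ‖x - y‖ := norm_pos_iff.2 (sub_ne_zero.2 hxy)
  have hq : 0 < holderQuot s u (x, y) := by
    unfold holderQuot
    have : 0 < |u x - u y| := abs_pos.2 (by rw [hx0, zero_sub]; exact neg_ne_zero.2 hne)
    have := Real.rpow_pos_of_pos hn s
    positivity
  have := div_pos (Y.G_pos hq) (pow_pos hn N)
  rw [ENNReal.ofReal_eq_zero] at hy'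
  linarith

end Aux

/-! ### The space `V = 𝒳_rad(B₁) ∩ Lᵖ(B₁)` -/

/-- `u` is (almost everywhere) a function of `|x|`. -/
def IsRadial {N : ℕ} (u : E N → ℝ) : Prop :=
  ∃ f : ℝ → ℝ, u =ᵐ[volume] fun x => f ‖x‖

/-- `V` as a subspace of the space of measurable functions on `ℝᴺ` modulo equality a.e.:
radial `u` with `u ∈ L²(B₁)`, finite modular, and `u ∈ Lᵖ(B₁)`. -/
noncomputable def vSubmodule (N : ℕ) (s p : ℝ) (Y : YoungFunction) [Y.Growth] :
    Submodule ℝ (E N →ₘ[volume] ℝ) where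
  carrier := {u | MemLp u 2 (volume.restrict (B₁ N)) ∧ modular s Y u < ∞ ∧ IsRadial u ∧
    MemLp u (ENNReal.ofReal p) (volume.restrict (B₁ N))}
  zero_mem' := by
    have h0 : ((0 : E N →ₘ[volume] ℝ) : E N → ℝ) =ᵐ[volume] fun _ => (0 : ℝ) :=
      AEEqFun.coeFn_zero
    refine ⟨(memLp_congr_ae (ae_restrict_of_ae h0)).2 MemLp.zero', ?_, ⟨fun _ => 0, h0⟩,
      (memLp_congr_ae (ae_restrict_of_ae h0)).2 MemLp.zero'⟩
    rw [modular_congr h0, modular_zero]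
    exact ENNReal.zero_lt_top
  add_mem' := by
    rintro u v ⟨hu1, hu2, ⟨f, hf⟩, hu3⟩ ⟨hv1, hv2, ⟨k, hk⟩, hv3⟩
    have h0 : ((u + v : E N →ₘ[volume] ℝ) : E N → ℝ) =ᵐ[volume] fun x => u x + v x :=
      AEEqFun.coeFn_add u v
    refine ⟨(memLp_congr_ae (ae_restrict_of_ae h0)).2 (hu1.add hv1), ?_,
      ⟨fun r => f r + k r, ?_⟩, (memLp_congr_ae (ae_restrict_of_ae h0)).2 (hu3.add hv3)⟩
    · rw [modular_congr h0]
      exact modular_add_lt_top u.measurable hu2 hv2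
    · filter_upwards [h0, hf, hk] with x h1 h2 h3
      rw [h1, h2, h3]
  smul_mem' := by
    rintro c u ⟨hu1, hu2, ⟨f, hf⟩, hu3⟩
    have h0 : ((c • u : E N →ₘ[volume] ℝ) : E N → ℝ) =ᵐ[volume] fun x => c * u x :=
      AEEqFun.coeFn_smul c u
    refine ⟨(memLp_congr_ae (ae_restrict_of_ae h0)).2 (hu1.const_mul c), ?_,
      ⟨fun r => c * f r, ?_⟩, (memLp_congr_ae (ae_restrict_of_ae h0)).2 (hu3.const_mul c)⟩
    · rw [modular_congr h0]
      exact modular_mul_lt_top c hu2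
    · filter_upwards [h0, hf] with x h1 h2
      rw [h1, h2]

/-- The space `V = 𝒳_rad(B₁) ∩ Lᵖ(B₁)`. -/
def V (N : ℕ) (s p : ℝ) (Y : YoungFunction) [Y.Growth] : Type :=
  vSubmodule N s p Y

section Space

variable {N : ℕ} {s p : ℝ} {Y : YoungFunction} [Y.Growth]

noncomputable instance : AddCommGroup (V N s p Y) :=
  inferInstanceAs (AddCommGroup (vSubmodule N s p Y))

noncomputable instance : Module ℝ (V N s p Y) :=
  inferInstanceAs (Module ℝ (vSubmodule N s p Y))

/-- A representative of an element of `V`. -/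
noncomputable def V.fn (u : V N s p Y) : E N → ℝ := (u.1 : E N → ℝ)

/-- `‖u‖_V = (‖u‖_{L²(B₁)} + [u]_{s,G,*}) + ‖u‖_{Lᵖ(B₁)}`. -/
noncomputable instance : Norm (V N s p Y) where
  norm u := ((eLpNorm u.fn 2 (volume.restrict (B₁ N))).toReal + luxemburg s Y u.fn) +
    (eLpNorm u.fn (ENNReal.ofReal p) (volume.restrict (B₁ N))).toReal

lemma V.norm_def (u : V N s p Y) :
    ‖u‖ = ((eLpNorm u.fn 2 (volume.restrict (B₁ N))).toReal + luxemburg s Y u.fn) +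
      (eLpNorm u.fn (ENNReal.ofReal p) (volume.restrict (B₁ N))).toReal := rfl

lemma V.measurable_fn (u : V N s p Y) : Measurable u.fn := u.1.measurable

lemma V.memLp_two (u : V N s p Y) : MemLp u.fn 2 (volume.restrict (B₁ N)) := u.2.1

lemma V.modular_lt_top (u : V N s p Y) : modular s Y u.fn < ∞ := u.2.2.1

lemma V.memLp (u : V N s p Y) : MemLp u.fn (ENNReal.ofReal p) (volume.restrict (B₁ N)) :=
  u.2.2.2.2

lemma V.fn_add (u v : V N s p Y) : (u + v).fn =ᵐ[volume] fun x => u.fn x + v.fn x :=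
  AEEqFun.coeFn_add u.1 v.1

lemma V.fn_smul (c : ℝ) (u : V N s p Y) : (c • u).fn =ᵐ[volume] fun x => c * u.fn x :=
  AEEqFun.coeFn_smul c u.1

lemma V.fn_zero : (0 : V N s p Y).fn =ᵐ[volume] fun _ => (0 : ℝ) :=
  AEEqFun.coeFn_zero (β := ℝ)

lemma V.eq_zero_of_fn {u : V N s p Y} (h : u.fn =ᵐ[volume] 0) : u = 0 :=
  Subtype.ext (AEEqFun.ext (h.trans AEEqFun.coeFn_zero.symm))

lemma V.eLpNorm_smul (c : ℝ) (u : V N s p Y) (r : ℝ≥0∞) :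
    (eLpNorm (c • u).fn r (volume.restrict (B₁ N))).toReal =
      |c| * (eLpNorm u.fn r (volume.restrict (B₁ N))).toReal := by
  have e : eLpNorm (c • u).fn r (volume.restrict (B₁ N)) =
      eLpNorm (c • u.fn) r (volume.restrict (B₁ N)) :=
    eLpNorm_congr_ae (ae_restrict_of_ae (V.fn_smul c u))
  rw [e, eLpNorm_const_smul, ENNReal.toReal_mul, toReal_enorm, Real.norm_eq_abs]

lemma V.eLpNorm_add_le {r : ℝ≥0∞} (hr : 1 ≤ r) {u v : V N s p Y}
    (hu : MemLp u.fn r (volume.restrict (B₁ N))) (hv : MemLp v.fn r (volume.restrict (B₁ N))) :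
    (eLpNorm (u + v).fn r (volume.restrict (B₁ N))).toReal ≤
      (eLpNorm u.fn r (volume.restrict (B₁ N))).toReal +
        (eLpNorm v.fn r (volume.restrict (B₁ N))).toReal := by
  have e : eLpNorm (u + v).fn r (volume.restrict (B₁ N)) =
      eLpNorm (u.fn + v.fn) r (volume.restrict (B₁ N)) :=
    eLpNorm_congr_ae (ae_restrict_of_ae (V.fn_add u v))
  rw [e, ← ENNReal.toReal_add hu.2.ne hv.2.ne]
  exact ENNReal.toReal_mono (ENNReal.add_ne_top.2 ⟨hu.2.ne, hv.2.ne⟩)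
    (MeasureTheory.eLpNorm_add_le hu.1 hv.1 hr)

lemma V.core [hp : Fact (2 < p)] : NormedSpace.Core ℝ (V N s p Y) where
  norm_nonneg u := by
    rw [V.norm_def]
    have := luxemburg_nonneg (s := s) (Y := Y) (u := u.fn)
    positivity
  norm_smul c u := by
    rw [V.norm_def, V.norm_def, V.eLpNorm_smul, V.eLpNorm_smul, luxemburg_congr (V.fn_smul c u),
      luxemburg_smul u.modular_lt_top, Real.norm_eq_abs]
    ring
  norm_triangle u v := by
    rw [V.norm_def, V.norm_def, V.norm_def, luxemburg_congr (V.fn_add u v)]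
    have h1 := V.eLpNorm_add_le (u := u) (v := v) one_le_two u.memLp_two v.memLp_two
    have h2 := luxemburg_add_le u.measurable_fn u.modular_lt_top v.modular_lt_top
    have h3 := V.eLpNorm_add_le (u := u) (v := v) (r := ENNReal.ofReal p)
      (ENNReal.one_le_ofReal.2 (by linarith [hp.out])) u.memLp v.memLp
    linarith
  norm_eq_zero_iff u := by
    constructor
    · intro h
      rw [V.norm_def] at h
      have h0 := luxemburg_nonneg (s := s) (Y := Y) (u := u.fn)
      have h1 : 0 ≤ (eLpNorm u.fn 2 (volume.restrict (B₁ N))).toReal := ENNReal.toReal_nonneg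
      have h2 : 0 ≤ (eLpNorm u.fn (ENNReal.ofReal p) (volume.restrict (B₁ N))).toReal :=
        ENNReal.toReal_nonneg
      have h3 : luxemburg s Y u.fn = 0 := by linarith
      have h4 : (eLpNorm u.fn 2 (volume.restrict (B₁ N))).toReal = 0 := by linarith
      rw [ENNReal.toReal_eq_zero_iff] at h4
      have h5 := h4.resolve_right u.memLp_two.2.ne
      rw [eLpNorm_eq_zero_iff u.memLp_two.1 two_ne_zero] at h5
      exact V.eq_zero_of_fn
        (ae_zero_of_modular u.measurable_fn (modular_eq_zero u.modular_lt_top h3) h5)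
    · rintro rfl
      have e : ∀ r : ℝ≥0∞, eLpNorm (0 : V N s p Y).fn r (volume.restrict (B₁ N)) = 0 := by
        intro r
        rw [eLpNorm_congr_ae (ae_restrict_of_ae V.fn_zero)]
        exact eLpNorm_zero'
      rw [V.norm_def, e, e, luxemburg_congr V.fn_zero, luxemburg_zero]
      simp

noncomputable instance [Fact (2 < p)] : NormedAddCommGroup (V N s p Y) :=
  NormedAddCommGroup.ofCore V.core

noncomputable instance [Fact (2 < p)] : NormedSpace ℝ (V N s p Y) :=
  NormedSpace.ofCore V.core

/-! ### The functionals and the cone -/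

/-- `Ψ(u) = ∬_𝒬 G(|u(x) - u(y)| / |x - y|ˢ) dx dy / |x - y|ᴺ + ½ ∫_{B₁} |u|² dx`
(the modular is finite on `V`). -/
noncomputable def Psi (u : V N s p Y) : ℝ :=
  (modular s Y u.fn).toReal + 1 / 2 * ∫ x in B₁ N, |u.fn x| ^ 2

/-- `Φ(u) = (1/p) ∫_{B₁} |u|ᵖ dx`. -/
noncomputable def Phi (u : V N s p Y) : ℝ :=
  1 / p * ∫ x in B₁ N, |u.fn x| ^ p

/-- The cone `K` of the (classes of) functions in `V` that are nonnegative and radially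
non-decreasing with respect to `r = |x|`. -/
def K (N : ℕ) (s p : ℝ) (Y : YoungFunction) [Y.Growth] : Set (V N s p Y) :=
  {u | (∀ᵐ x ∂(volume : Measure (E N)), 0 ≤ u.fn x) ∧
    ∃ f : ℝ → ℝ, MonotoneOn f (Ici 0) ∧ u.fn =ᵐ[volume] fun x => f ‖x‖}

open Classical in
/-- `Ψ_K = Ψ` on `K` and `Ψ_K = +∞` outside `K`. -/
noncomputable def PsiK (u : V N s p Y) : EReal :=
  if u ∈ K N s p Y then (Psi u : EReal) else ⊤

end Space

/-! ### The Palais–Smale condition -/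

section PS

variable {W : Type*} [NormedAddCommGroup W] [NormedSpace ℝ W]

/-- Szulkin's Palais–Smale condition at the level `c` for `I = Ψ - Φ`, with `Ψ` with values in
`(-∞, +∞]` and `Φ` of class `C¹`. The inequality
`⟨DΦ(uₙ), uₙ - v⟩ + Ψ(v) - Ψ(uₙ) ≥ -εₙ ‖uₙ - v‖` is written without the difference
`Ψ(v) - Ψ(uₙ)`, which may be `∞ - ∞`; it forces `Ψ(uₙ) < ∞` as soon as `Ψ` is proper. -/
def PalaisSmaleAt (Ψ : W → EReal) (Φ : W → ℝ) (c : ℝ) : Prop :=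
  ∀ (u : ℕ → W) (ε : ℕ → ℝ),
    Tendsto (fun n => Ψ (u n) - (Φ (u n) : EReal)) atTop (𝓝 (c : EReal)) →
    Tendsto ε atTop (𝓝 0) →
    (∀ n v, Ψ (u n) ≤
      Ψ v + ((fderiv ℝ Φ (u n) (u n - v) + ε n * ‖u n - v‖ : ℝ) : EReal)) →
    ∃ (φ : ℕ → ℕ) (a : W), StrictMono φ ∧ Tendsto (fun k => u (φ k)) atTop (𝓝 a)

/-- Szulkin's Palais–Smale condition (at every level) for `I = Ψ - Φ`. -/
def PalaisSmale (Ψ : W → EReal) (Φ : W → ℝ) : Prop :=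
  ∀ c : ℝ, PalaisSmaleAt Ψ Φ c

end PS

end FracOrlicz

namespace FracOrlicz

/-! ### Elementary inequalities for real powers -/

/-! Boundedness comes from testing the variational inequality with `v = (1 + r) • u n`, which stays
in the cone. Since `q⁺ < p`, some `κ < p` and some small `r > 0` satisfy `Ψ((1 + r)u) ≤ (1 + κ r)
Ψ(u)` (`exists_dilation`, `Psi_dilation_le`), while Euler's identity gives `⟨DΦ(u), u⟩ = p Φ(u)`.
Hence `p Φ(u n) ≤ κ Ψ(u n) + |ε n| ‖u n‖`. As `Ψ(u n) - Φ(u n)` is bounded and `‖u‖` is at most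
affine in `Ψ(u)` and `Φ(u)` (`V.norm_le`), the error term is absorbed by `(p - κ) Ψ(u n)` once `ε n`
is small (`eventually_bounded`).

For compactness, monotonicity replaces any Sobolev embedding. A bound on `Ψ` controls the radial
profile at every radius: the `L²` norm controls it at `1/2`, and the modular controls the increment
from there to any radius beyond the ball (`exists_radial_bound`). Helly selection then gives a
subsequence converging a.e. on the whole space. By Fatou the limit `a` has finite modular, so it
lies in `K`. Inside `B₁` the profiles are uniformly bounded, and bounded convergence yields
convergence in `L²(B₁)` and `Lᵖ(B₁)`.

There remains the seminorm. Testing with `v = a` gives `ρ(u n) ≤ ρ(a) + o(1)` along the subsequence,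
because the derivative term and the `L²` terms are already under control. With a.e. convergence and
the doubling property of `G`, this forces `ρ(u n - a) → 0` (`tendsto_modular_sub`), hence
convergence in the Luxemburg seminorm. -/

lemma rpow_tangent_le {q a b : ℝ} (hq : 1 < q) (ha : 0 ≤ a) (hb : 0 ≤ b) :
    a ^ q + q * a ^ (q - 1) * (b - a) ≤ b ^ q := by
  rcases ha.eq_or_lt with rfl | ha
  · rw [Real.zero_rpow (by linarith), Real.zero_rpow (by linarith)]
    simpa using Real.rpow_nonneg hb q
  -- Bernoulli's inequality for `b / a = 1 + (b / a - 1)`, to be multiplied by `a ^ q`.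
  · have h := one_add_mul_self_le_rpow_one_add (s := b / a - 1)
      (by linarith [div_nonneg hb ha.le]) hq.le
    rw [add_sub_cancel, Real.div_rpow hb ha.le, le_div_iff₀ (by positivity)] at h
    have e : a ^ q = a ^ (q - 1) * a := by
      rw [← Real.rpow_add_one ha.ne']; ring_nf
    calc _ = (1 + q * (b / a - 1)) * a ^ q := by rw [e]; field_simp
      _ ≤ _ := h

/-- The tangent at the larger of the two points lies below the power, and its slope is at most `q *
m ^ (q - 1)`. -/
lemma abs_rpow_sub_rpow_le {q a b m : ℝ} (hq : 1 < q) (ha : 0 ≤ a) (hb : 0 ≤ b)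
    (ham : a ≤ m) (hbm : b ≤ m) : |b ^ q - a ^ q| ≤ q * m ^ (q - 1) * |b - a| := by
  have key : ∀ x y : ℝ, 0 ≤ x → 0 ≤ y → x ≤ m → y ≤ m → x ≤ y →
      |y ^ q - x ^ q| ≤ q * m ^ (q - 1) * |y - x| := by
    intro x y hx hy hxm hym hxy
    have h1 := rpow_tangent_le hq hy hx
    have h2 := Real.rpow_le_rpow hx hxy (by linarith : 0 ≤ q)
    have h3 := Real.rpow_le_rpow hy hym (by linarith : 0 ≤ q - 1)
    rw [abs_of_nonneg (by linarith), abs_of_nonneg (by linarith)]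
    have h4 : q * y ^ (q - 1) * (y - x) ≤ q * m ^ (q - 1) * (y - x) := by
      gcongr
    linarith
  rcases le_total a b with h | h
  · exact key a b ha hb ham hbm h
  · rw [abs_sub_comm, abs_sub_comm b]
    exact key b a hb ha hbm ham h

/-- First-order Taylor remainder of `|t| ^ p` at a point of a bounded interval `[0, M]`. -/
lemma abs_rpow_remainder_le {p a h M : ℝ} (hp : 2 < p) (ha : 0 ≤ a) (haM : a ≤ M) :
    |(|a + h| ^ p - |a| ^ p - p * a ^ (p - 1) * h)| ≤
      (p * (p - 1) * (M + 1) ^ (p - 2) + (2 + p)) * (h ^ 2 + |h| ^ p) := by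
  have hM : 0 ≤ M := ha.trans haM
  have hh : 0 ≤ |h| ^ p := by positivity
  have hC : 0 ≤ p * (p - 1) * (M + 1) ^ (p - 2) := by
    have : 0 ≤ p - 1 := by linarith
    positivity
  rw [abs_of_nonneg ha]
  rcases le_or_gt 0 (a + h) with hb | hb
  -- Tangents at `a` and at `a + h` place the remainder between `0` and `p ((a + h)^(p-1) - a^(p-1))
  -- h`, which is quadratic in `h` up to the factor `(M + |h|)^(p-2)`. For `|h| ≥ 1` this factor is
  -- absorbed into `|h| ^ p`.
  · rw [abs_of_nonneg hb]
    have h1 := rpow_tangent_le (q := p) (by linarith) ha hb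
    have h2 := rpow_tangent_le (q := p) (by linarith) hb ha
    have h3 := abs_rpow_sub_rpow_le (q := p - 1) (m := M + |h|) (by linarith) ha hb
      (by linarith [abs_nonneg h]) (by linarith [le_abs_self h])
    rw [add_sub_cancel_left, show p - 1 - 1 = p - 2 by ring] at h3
    have h4 : ((a + h) ^ (p - 1) - a ^ (p - 1)) * h ≤
        (p - 1) * (M + |h|) ^ (p - 2) * |h| * |h| := by
      refine (le_abs_self _).trans ?_
      rw [abs_mul]
      gcongr
    have h5 : (M + |h|) ^ (p - 2) * |h| * |h| ≤ (M + 1) ^ (p - 2) * (h ^ 2 + |h| ^ p) := by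
      rcases le_total |h| 1 with hle | hle
      · have : (M + |h|) ^ (p - 2) ≤ (M + 1) ^ (p - 2) :=
          Real.rpow_le_rpow (by positivity) (by linarith) (by linarith)
        calc (M + |h|) ^ (p - 2) * |h| * |h| = (M + |h|) ^ (p - 2) * h ^ 2 := by
              rw [mul_assoc, ← sq, sq_abs]
          _ ≤ (M + 1) ^ (p - 2) * (h ^ 2 + |h| ^ p) := by gcongr; linarith
      · have : (M + |h|) ^ (p - 2) ≤ ((M + 1) * |h|) ^ (p - 2) :=
          Real.rpow_le_rpow (by positivity) (by nlinarith) (by linarith)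
        rw [Real.mul_rpow (by positivity) (by positivity)] at this
        have hpos : 0 < |h| := by linarith
        have e : |h| ^ (p - 2) * |h| * |h| = |h| ^ p := by
          rw [← Real.rpow_add_one hpos.ne', ← Real.rpow_add_one hpos.ne']
          ring_nf
        calc (M + |h|) ^ (p - 2) * |h| * |h|
            ≤ (M + 1) ^ (p - 2) * |h| ^ (p - 2) * |h| * |h| := by gcongr
          _ = (M + 1) ^ (p - 2) * |h| ^ p := by rw [← e]; ring
          _ ≤ (M + 1) ^ (p - 2) * (h ^ 2 + |h| ^ p) := by gcongr; nlinarith [sq_nonneg h]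
    have h6 := mul_le_mul_of_nonneg_left h5 (show 0 ≤ p * (p - 1) by nlinarith)
    have h7 := mul_le_mul_of_nonneg_left h4 (show 0 ≤ p by linarith)
    have h8 : 0 ≤ (2 + p) * (h ^ 2 + |h| ^ p) := by positivity
    rw [add_sub_cancel_left] at h1
    rw [abs_of_nonneg (by linarith)]
    nlinarith
  -- Here `a < |h|`, so the three terms of the remainder are at most `|h|^p`, `|h|^p` and `p |h|^p`;
  -- this is the constant `2 + p`.
  · have hneg : h < 0 := by linarith
    have hah : a ≤ |h| := by rw [abs_of_neg hneg]; linarith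
    have hpos : 0 < |h| := abs_pos.2 hneg.ne
    have h1 : |a + h| ^ p ≤ |h| ^ p := by
      apply Real.rpow_le_rpow (abs_nonneg _) _ (by linarith)
      rw [abs_of_neg hb, abs_of_neg hneg]; linarith
    have h2 : a ^ p ≤ |h| ^ p := Real.rpow_le_rpow ha hah (by linarith)
    have h3 : a ^ (p - 1) * |h| ≤ |h| ^ p := by
      calc a ^ (p - 1) * |h| ≤ |h| ^ (p - 1) * |h| := by
            gcongr
            linarith
        _ = |h| ^ p := by rw [← Real.rpow_add_one hpos.ne']; ring_nf
    have h4 : |p * a ^ (p - 1) * h| ≤ p * |h| ^ p := by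
      rw [abs_mul, abs_mul, abs_of_nonneg (by linarith : 0 ≤ p),
        abs_of_nonneg (Real.rpow_nonneg ha _), mul_assoc]
      gcongr
    have h5 : 0 ≤ |a + h| ^ p := by positivity
    have h6 : 0 ≤ a ^ p := by positivity
    have h7 : 0 ≤ p * (p - 1) * (M + 1) ^ (p - 2) * (h ^ 2 + |h| ^ p) := by positivity
    have h8 : 0 ≤ (2 + p) * h ^ 2 := by positivity
    have h9 := abs_le.1 h4
    rw [abs_le]
    constructor <;> nlinarith

/-! ### Helly selection -/

/-- Helly's selection theorem for locally bounded sequences of nonnegative monotone functions: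
convergence holds at every continuity point of the limit. -/
lemma exists_subseq_tendsto_of_monotone {f : ℕ → ℝ → ℝ} {M : ℝ → ℝ}
    (hf : ∀ n, Monotone (f n)) (hf0 : ∀ n r, 0 ≤ f n r) (hM : ∀ n r, f n r ≤ M r) :
    ∃ (φ : ℕ → ℕ) (g : ℝ → ℝ), StrictMono φ ∧ Monotone g ∧ (∀ r, 0 ≤ g r) ∧
      ∀ r, ContinuousAt g r → Tendsto (fun k => f (φ k) r) atTop (𝓝 (g r)) := by
  have hc : IsCompact (Set.pi univ fun q : ℚ => Icc (0 : ℝ) (M q)) :=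
    isCompact_univ_pi fun _ => isCompact_Icc
  -- The product over the countable set `ℚ` is compact and first countable, so this single
  -- extraction plays the role of the diagonal argument.
  obtain ⟨L, hL, φ, hφ, hlim⟩ := hc.tendsto_subseq (x := fun n (q : ℚ) => f n q)
    (fun n q _ => ⟨hf0 n q, hM n q⟩)
  rw [tendsto_pi_nhds] at hlim
  have hL0 : ∀ q, 0 ≤ L q := fun q => (hL q (mem_univ _)).1
  have hLmono : Monotone L := fun a b hab =>
    le_of_tendsto_of_tendsto' (hlim a) (hlim b) fun k => hf _ (by exact_mod_cast hab)
  -- The limit is defined as the infimum of the rational limits strictly to the right of `r`. At a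
  -- continuity point of this function, rationals on both sides squeeze the sequence.
  let S : ℝ → Set ℝ := fun r => L '' {q : ℚ | r < q}
  have hSne : ∀ r, (S r).Nonempty := fun r =>
    (exists_rat_gt r).elim fun q hq => ⟨L q, q, hq, rfl⟩
  have hSb : ∀ r, BddBelow (S r) := fun r => ⟨0, by rintro _ ⟨q, _, rfl⟩; exact hL0 q⟩
  have hle : ∀ (r : ℝ) (q : ℚ), r < q → sInf (S r) ≤ L q := fun r q hq =>
    csInf_le (hSb r) ⟨q, hq, rfl⟩
  have hge : ∀ (r : ℝ) (q : ℚ), (q : ℝ) ≤ r → L q ≤ sInf (S r) := by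
    intro r q hq
    refine le_csInf (hSne r) ?_
    rintro _ ⟨q', hq', rfl⟩
    exact hLmono (by exact_mod_cast hq.trans hq'.le)
  refine ⟨φ, fun r => sInf (S r), hφ, ?_, ?_, ?_⟩
  · intro a b hab
    exact csInf_le_csInf (hSb a) (hSne b) (image_mono fun q hq => lt_of_le_of_lt hab hq)
  · intro r
    exact Real.sInf_nonneg (by rintro _ ⟨q, _, rfl⟩; exact hL0 q)
  · intro r hr
    rw [tendsto_order]
    have hr' := hr.tendsto
    rw [tendsto_order] at hr'
    constructor
    · intro a ha
      obtain ⟨r', hr'a, hr'r⟩ :=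
        ((((hr'.1 a ha).filter_mono nhdsWithin_le_nhds).and
          (self_mem_nhdsWithin : Iio r ∈ 𝓝[<] r))).exists
      obtain ⟨q, hq1, hq2⟩ := exists_rat_btwn hr'r
      have h1 : a < L q := hr'a.trans_le (hle r' q hq1)
      filter_upwards [(tendsto_order.1 (hlim q)).1 a h1] with k hk
      exact hk.trans_le (hf _ hq2.le)
    · intro a ha
      obtain ⟨r', hr'a, hr'r⟩ :=
        ((((hr'.2 a ha).filter_mono nhdsWithin_le_nhds).and
          (self_mem_nhdsWithin : Ioi r ∈ 𝓝[>] r))).exists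
      obtain ⟨q, hq1, hq2⟩ := exists_rat_btwn hr'r
      have h1 : L q < a := (hge r' q hq2.le).trans_lt hr'a
      filter_upwards [(tendsto_order.1 (hlim q)).2 a h1] with k hk
      exact (hf _ hq1.le).trans_lt hk

/-! ### Young functions -/

namespace YoungFunction

variable (Y : YoungFunction)

/-- Truncation at `0` makes the density monotone on all of `ℝ`, hence locally integrable, and its
primitive continuous, without any assumption on `g` at negative arguments. -/
lemma continuous_G_max : Continuous (fun t : ℝ => Y.G (max t 0)) := by
  have hm : Monotone fun t : ℝ => Y.g (max t 0) := fun a b hab =>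
    Y.g_monoOn (mem_Ici.2 (le_max_right a 0)) (mem_Ici.2 (le_max_right b 0))
      (max_le_max_right 0 hab)
  have hc := (intervalIntegral.continuous_primitive (μ := volume)
    (fun a b => hm.intervalIntegrable (a := a) (b := b)) 0).comp
    (continuous_id.max continuous_const : Continuous fun t : ℝ => max t 0)
  convert hc using 2 with t
  refine intervalIntegral.integral_congr fun x hx => ?_
  rw [uIcc_of_le (le_max_right _ _)] at hx
  simp only [max_eq_left hx.1]

lemma tendsto_G {ι : Type*} {l : Filter ι} {a : ι → ℝ} {b : ℝ} (ha : ∀ i, 0 ≤ a i) (hb : 0 ≤ b)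
    (h : Tendsto a l (𝓝 b)) : Tendsto (fun i => Y.G (a i)) l (𝓝 (Y.G b)) := by
  have := (Y.continuous_G_max.tendsto b).comp h
  simpa only [Function.comp_def, max_eq_left (ha _), max_eq_left hb] using this

/-- The supporting line of `G` at `1` has slope `g 1 > 0`, so `G` grows at least linearly. This
turns a bound on the modular into a pointwise bound. -/
lemma le_of_G_le {t C : ℝ} (ht : 0 ≤ t) (h : Y.G t ≤ C) : t ≤ 1 + C / Y.g 1 := by
  have h1 := Y.G_support zero_le_one ht
  have h2 := Y.g_pos 1 one_pos
  have h3 := Y.G_pos one_pos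
  rw [← sub_le_iff_le_add', le_div_iff₀ h2]
  linarith

/-- Convexity at the midpoint of `2a` and `2b`, followed by doubling. -/
lemma G_add_le [Y.Growth] :
    ∃ C : ℝ, 0 ≤ C ∧ ∀ a b, 0 ≤ a → 0 ≤ b → Y.G (a + b) ≤ C * (Y.G a + Y.G b) := by
  obtain ⟨C, hC, h⟩ := Y.exists_doubling (zero_le_two (α := ℝ))
  refine ⟨C, hC, fun a b ha hb => ?_⟩
  have h1 := Y.G_convex (a := 2 * a) (b := 2 * b) (α := 1 / 2) (β := 1 / 2)
    (by positivity) (by positivity) (by norm_num) (by norm_num) (by norm_num)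
  have h2 := h a ha
  have h3 := h b hb
  have h4 := mul_nonneg hC (Y.G_nonneg ha)
  have h5 := mul_nonneg hC (Y.G_nonneg hb)
  rw [show 1 / 2 * (2 * a) + 1 / 2 * (2 * b) = a + b by ring] at h1
  nlinarith

/-- Dilations close to the identity increase `G` at a rate arbitrarily close to `q⁺`. -/
lemma exists_dilation [hY : Y.Growth] {p : ℝ} (hqm : 2 ≤ Y.qMinus) (hqp : Y.qPlus < p) :
    ∃ κ r : ℝ, κ < p ∧ 0 < r ∧ 2 + r ≤ κ ∧
      ∀ t, 0 ≤ t → Y.G ((1 + r) * t) ≤ (1 + κ * r) * Y.G t := by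
  set q := Y.qPlus
  have hmem : (1 : ℝ) * Y.g 1 / Y.G 1 ∈ Y.quotients := ⟨1, mem_Ioi.2 one_pos, rfl⟩
  -- Only `2 ≤ q⁺` is extracted from the assumption on `q⁻`; it makes `κ > 2`, which leaves room for
  -- the quadratic part of `Ψ`.
  have hq2 : 2 ≤ q := by
    have hb : BddBelow Y.quotients := by
      refine ⟨0, ?_⟩
      rintro _ ⟨t, ht, rfl⟩
      exact div_nonneg (mul_nonneg (mem_Ioi.1 ht).le (Y.g_nonneg (mem_Ioi.1 ht).le))
        (Y.G_nonneg (mem_Ioi.1 ht).le)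
    exact hqm.trans ((csInf_le hb hmem).trans (le_csSup hY.bddAbove hmem))
  have hq : ∀ t, 0 < t → t * Y.g t ≤ q * Y.G t := fun t ht =>
    (div_le_iff₀ (Y.G_pos ht)).1 (le_csSup hY.bddAbove ⟨t, ht, rfl⟩)
  obtain ⟨κ, hκ1, hκ2⟩ := exists_between hqp
  -- The first bound on `r` is exactly the condition `1 + r ≤ (1 + κ r)(1 + r - q r)` used for `G`;
  -- the second gives `(1 + r)² ≤ 1 + κ r` for the `L²` term.
  set r := min ((κ - q) / (κ * (q - 1))) (κ - 2)
  have hq1 : 0 < q - 1 := by linarith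
  have hκ0 : 0 < κ := by linarith
  have hκq : 0 < κ - q := by linarith
  have hr : 0 < r := lt_min (by positivity) (by linarith)
  have hr1 : r * (κ * (q - 1)) ≤ κ - q := by
    rw [← le_div_iff₀ (by positivity)]
    exact min_le_left _ _
  refine ⟨κ, r, hκ2, hr, by linarith [min_le_right ((κ - q) / (κ * (q - 1))) (κ - 2)], ?_⟩
  intro t ht
  rcases ht.eq_or_lt with rfl | ht
  · simp [Y.G_zero]
  have hy : 0 < (1 + r) * t := by positivity
  have h1 := Y.G_support hy.le ht.le
  have h2 := hq _ hy
  have hG := Y.G_nonneg ht.le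
  have hGy := Y.G_pos hy
  -- The supporting line at `y = (1 + r) t`, evaluated at `t`, with `y g(y) ≤ q G(y)`.
  have h3 : Y.G ((1 + r) * t) * (1 + r - q * r) ≤ (1 + r) * Y.G t := by
    nlinarith
  have h4 : 1 + r ≤ (1 + κ * r) * (1 + r - q * r) := by
    nlinarith
  have h5 : 0 < 1 + r - q * r := by
    by_contra hcon
    push Not at hcon
    nlinarith [mul_nonneg hκ0.le hr.le]
  have h6 := mul_le_mul_of_nonneg_right h4 hG
  rw [← mul_le_mul_iff_left₀ h5]
  nlinarith

end YoungFunction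

/-! ### A generalized dominated convergence theorem -/

/-- If `aₙ → a` and `bₙ → 0` a.e., `bₙ ≤ C (aₙ + a)` and `limsup ∫ aₙ ≤ ∫ a < ∞`, then
`∫ bₙ → 0`. -/
lemma tendsto_lintegral_zero_of_le {α : Type*} [MeasurableSpace α] {μ : Measure α}
    {a b : ℕ → α → ℝ≥0∞} {a' : α → ℝ≥0∞} {C : ℝ≥0∞} {δ : ℕ → ℝ≥0∞}
    (ham : ∀ n, AEMeasurable (a n) μ) (ha'm : AEMeasurable a' μ)
    (hbm : ∀ n, AEMeasurable (b n) μ) (hC : C ≠ ∞)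
    (ha : ∀ᵐ x ∂μ, Tendsto (fun n => a n x) atTop (𝓝 (a' x)))
    (hb : ∀ᵐ x ∂μ, Tendsto (fun n => b n x) atTop (𝓝 0))
    (hle : ∀ n x, b n x ≤ C * (a n x + a' x)) (hfin : ∫⁻ x, a' x ∂μ ≠ ∞)
    (hδ : Tendsto δ atTop (𝓝 0)) (hlim : ∀ n, ∫⁻ x, a n x ∂μ ≤ ∫⁻ x, a' x ∂μ + δ n) :
    Tendsto (fun n => ∫⁻ x, b n x ∂μ) atTop (𝓝 0) := by
  have hmin : Tendsto (fun n => ∫⁻ x, min (a n x) (a' x) ∂μ) atTop (𝓝 (∫⁻ x, a' x ∂μ)) := by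
    apply tendsto_lintegral_of_dominated_convergence' a' (fun n => (ham n).inf ha'm)
      (fun n => ae_of_all _ fun x => min_le_right _ _) hfin
    filter_upwards [ha] with x hx
    simpa using hx.min (tendsto_const_nhds (x := a' x))
  have hminfin : ∀ n, ∫⁻ x, min (a n x) (a' x) ∂μ ≠ ∞ := fun n =>
    ne_top_of_le_ne_top hfin (lintegral_mono fun x => min_le_right _ _)
  -- The positive part satisfies `∫ (aₙ - a)⁺ = ∫ aₙ - ∫ min(aₙ, a) ≤ ∫ a + δₙ - ∫ min(aₙ, a)`, and
  -- the right-hand side tends to `0`. An upper bound on `∫ aₙ` is therefore enough.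
  have hsub : Tendsto (fun n => ∫⁻ x, (a n x - a' x) ∂μ) atTop (𝓝 0) := by
    have h1 : Tendsto (fun n => (∫⁻ x, a' x ∂μ + δ n) - ∫⁻ x, min (a n x) (a' x) ∂μ) atTop
        (𝓝 (∫⁻ x, a' x ∂μ + 0 - ∫⁻ x, a' x ∂μ)) :=
      ENNReal.Tendsto.sub (tendsto_const_nhds.add hδ) hmin (Or.inr hfin)
    rw [add_zero, tsub_self] at h1
    refine tendsto_of_tendsto_of_tendsto_of_le_of_le tendsto_const_nhds h1 (fun _ => zero_le) ?_
    intro n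
    have e : ∫⁻ x, (a n x - a' x) ∂μ + ∫⁻ x, min (a n x) (a' x) ∂μ = ∫⁻ x, a n x ∂μ := by
      exact (lintegral_add_left' ((ham n).sub ha'm) _).symm.trans
        (lintegral_congr fun x => tsub_add_min)
    exact ENNReal.le_sub_of_add_le_right (hminfin n) (e.trans_le (hlim n))
  have hdom : Tendsto (fun n => ∫⁻ x, min (b n x) (C * (a' x + a' x)) ∂μ) atTop (𝓝 0) := by
    have := tendsto_lintegral_of_dominated_convergence' (μ := μ) (f := fun _ => 0)
      (F := fun n x => min (b n x) (C * (a' x + a' x))) (fun x => C * (a' x + a' x))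
      (fun n => (hbm n).inf ((ha'm.add ha'm).const_mul C))
      (fun n => ae_of_all _ fun x => min_le_right _ _)
      (by
        rw [lintegral_const_mul' _ _ hC, lintegral_add_left' ha'm]
        exact ENNReal.mul_ne_top hC (ENNReal.add_ne_top.2 ⟨hfin, hfin⟩))
      (by
        filter_upwards [hb] with x hx
        simpa using hx.min (tendsto_const_nhds (x := C * (a' x + a' x))))
    simpa using this
  have hsum := hdom.add (ENNReal.Tendsto.const_mul hsub (Or.inr hC))
  rw [mul_zero, add_zero] at hsum
  refine tendsto_of_tendsto_of_tendsto_of_le_of_le tendsto_const_nhds hsum (fun _ => zero_le) ?_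
  -- The splitting is `bₙ ≤ min(bₙ, 2 C a) + C (aₙ - a)⁺`: the first term is dominated, the second
  -- is small by `hsub`.
  intro n
  beta_reduce
  rw [← lintegral_const_mul' _ _ hC]
  refine le_trans (lintegral_mono fun x => ?_)
    (lintegral_add_left' ((hbm n).inf ((ha'm.add ha'm).const_mul C)) _).le
  change b n x ≤ min (b n x) (C * (a' x + a' x)) + C * (a n x - a' x)
  rcases le_total (b n x) (C * (a' x + a' x)) with h | h
  · rw [min_eq_left h]; exact le_self_add
  · rw [min_eq_right h, ← mul_add]
    refine (hle n x).trans ?_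
    refine mul_le_mul' le_rfl ?_
    calc a n x + a' x ≤ (a n x - a' x + a' x) + a' x := add_le_add le_tsub_add le_rfl
      _ = a' x + a' x + (a n x - a' x) := by ring

/-! ### The integrand of the modular -/

/-- The integrand of the modular. -/
noncomputable def modularDensity {N : ℕ} (s : ℝ) (Y : YoungFunction) (u : E N → ℝ)
    (z : E N × E N) : ℝ≥0∞ :=
  ENNReal.ofReal (Y.G (holderQuot s u z) / ‖z.1 - z.2‖ ^ N)

section Density

variable {N : ℕ} {s : ℝ} {Y : YoungFunction}

lemma modular_eq (u : E N → ℝ) : modular s Y u = ∫⁻ z in Q N, modularDensity s Y u z := rfl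

lemma measurable_modularDensity {u : E N → ℝ} (hu : Measurable u) :
    Measurable (modularDensity s Y u) := measurable_integrand hu

lemma tendsto_modularDensity {u : ℕ → E N → ℝ} {v : E N → ℝ} {z : E N × E N}
    (h1 : Tendsto (fun n => u n z.1) atTop (𝓝 (v z.1)))
    (h2 : Tendsto (fun n => u n z.2) atTop (𝓝 (v z.2))) :
    Tendsto (fun n => modularDensity s Y (u n) z) atTop (𝓝 (modularDensity s Y v z)) := by
  apply ENNReal.tendsto_ofReal
  apply Tendsto.div_const
  apply Y.tendsto_G (fun n => holderQuot_nonneg z) (holderQuot_nonneg z)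
  exact ((h1.sub h2).abs).div_const _

lemma modularDensity_zero (z : E N × E N) :
    modularDensity s Y (fun _ => (0 : ℝ)) z = 0 := by
  simp [modularDensity, holderQuot, Y.G_zero]

/-- The triangle inequality for the quotients and the doubling property of `G`. The constant is
uniform in the functions and the point, as the domination hypothesis of
`tendsto_lintegral_zero_of_le` requires. -/
lemma modularDensity_sub_le [Y.Growth] : ∃ C : ℝ, ∀ (u v : E N → ℝ) (z : E N × E N),
    modularDensity s Y (fun x => u x - v x) z ≤
      ENNReal.ofReal C * (modularDensity s Y u z + modularDensity s Y v z) := by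
  obtain ⟨C, hC, h⟩ := Y.G_add_le
  refine ⟨C, fun u v z => ?_⟩
  have hu := holderQuot_nonneg (s := s) (u := u) z
  have hv := holderQuot_nonneg (s := s) (u := v) z
  unfold modularDensity
  rw [← ENNReal.ofReal_add (div_nonneg (Y.G_nonneg hu) (by positivity))
    (div_nonneg (Y.G_nonneg hv) (by positivity)), ← ENNReal.ofReal_mul hC]
  apply ENNReal.ofReal_le_ofReal
  rw [← add_div, ← mul_div_assoc]
  apply div_le_div_of_nonneg_right _ (by positivity)
  refine (Y.G_mono (holderQuot_nonneg z) ?_).trans (h _ _ hu hv)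
  unfold holderQuot
  rw [← add_div]
  apply div_le_div_of_nonneg_right _ (by positivity)
  have e : u z.1 - v z.1 - (u z.2 - v z.2) = (u z.1 - u z.2) - (v z.1 - v z.2) := by ring
  rw [e]
  exact abs_sub _ _

lemma ae_prod_of_ae {P : E N → Prop} (h : ∀ᵐ x ∂(volume : Measure (E N)), P x) :
    ∀ᵐ z ∂(volume : Measure (E N × E N)).restrict (Q N), P z.1 ∧ P z.2 := by
  apply ae_restrict_of_ae
  have h1 : ∀ᵐ z : E N × E N ∂(volume : Measure (E N)).prod volume, P z.1 :=
    Measure.quasiMeasurePreserving_fst.ae h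
  have h2 : ∀ᵐ z : E N × E N ∂(volume : Measure (E N)).prod volume, P z.2 :=
    Measure.quasiMeasurePreserving_snd.ae h
  exact h1.and h2

/-- Lower semicontinuity of the modular under a.e. convergence. -/
lemma modular_le_of_tendsto_ae {u : ℕ → E N → ℝ} {v : E N → ℝ} {C : ℝ≥0∞}
    (hu : ∀ n, Measurable (u n))
    (h : ∀ᵐ x ∂(volume : Measure (E N)), Tendsto (fun n => u n x) atTop (𝓝 (v x)))
    (hC : ∀ n, modular s Y (u n) ≤ C) : modular s Y v ≤ C := by
  have e : modular s Y v = ∫⁻ z in Q N, liminf (fun n => modularDensity s Y (u n) z) atTop := by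
    rw [modular_eq]
    apply lintegral_congr_ae
    filter_upwards [ae_prod_of_ae h] with z hz
    exact (tendsto_modularDensity hz.1 hz.2).liminf_eq.symm
  rw [e]
  refine (lintegral_liminf_le fun n => measurable_modularDensity (hu n)).trans ?_
  exact liminf_le_of_le (by isBoundedDefault) fun b hb => by
    obtain ⟨n, hn⟩ := hb.exists
    exact hn.trans (hC n)

/-- Almost everywhere convergence and `limsup ρ(uₙ) ≤ ρ(v) < ∞` give `ρ(uₙ - v) → 0`. -/
lemma tendsto_modular_sub [Y.Growth] {u : ℕ → E N → ℝ} {v : E N → ℝ} {δ : ℕ → ℝ≥0∞}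
    (hu : ∀ n, Measurable (u n)) (hv : Measurable v)
    (h : ∀ᵐ x ∂(volume : Measure (E N)), Tendsto (fun n => u n x) atTop (𝓝 (v x)))
    (hfin : modular s Y v < ∞) (hδ : Tendsto δ atTop (𝓝 0))
    (hle : ∀ n, modular s Y (u n) ≤ modular s Y v + δ n) :
    Tendsto (fun n => modular s Y (fun x => u n x - v x)) atTop (𝓝 0) := by
  obtain ⟨C, hC⟩ := modularDensity_sub_le (N := N) (s := s) (Y := Y)
  refine tendsto_lintegral_zero_of_le (μ := volume.restrict (Q N))
    (b := fun n => modularDensity s Y (fun x => u n x - v x))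
    (a := fun n => modularDensity s Y (u n)) (a' := modularDensity s Y v)
    (C := ENNReal.ofReal C) (fun n => (measurable_modularDensity (hu n)).aemeasurable)
    (measurable_modularDensity hv).aemeasurable
    (fun n => (measurable_modularDensity ((hu n).sub hv)).aemeasurable) ENNReal.ofReal_ne_top
    ?_ ?_ (fun n z => hC _ _ z) hfin.ne hδ hle
  · filter_upwards [ae_prod_of_ae h] with z hz
    exact tendsto_modularDensity hz.1 hz.2
  · filter_upwards [ae_prod_of_ae h] with z hz
    rw [← modularDensity_zero (s := s) (Y := Y) z]
    apply tendsto_modularDensity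
    · simpa using hz.1.sub_const (v z.1)
    · simpa using hz.2.sub_const (v z.2)

/-- Modular convergence implies convergence in the Luxemburg seminorm. -/
lemma tendsto_luxemburg_zero [Y.Growth] {u : ℕ → E N → ℝ}
    (h : Tendsto (fun n => modular s Y (u n)) atTop (𝓝 0)) :
    Tendsto (fun n => luxemburg s Y (u n)) atTop (𝓝 0) := by
  rw [tendsto_order]
  refine ⟨fun a ha => Eventually.of_forall fun n => ha.trans_le luxemburg_nonneg, ?_⟩
  intro a ha
  have hl : 0 < a / 2 := by positivity
  -- Doubling with the factor `2 / a` gives `ρ(u / (a / 2)) ≤ C ρ(u)`, so `a / 2` is eventually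
  -- admissible in the Luxemburg infimum.
  obtain ⟨C, hC, hC'⟩ := Y.exists_doubling (inv_nonneg.2 hl.le)
  have h1 := ENNReal.Tendsto.const_mul (a := ENNReal.ofReal C) h (Or.inr ENNReal.ofReal_ne_top)
  rw [mul_zero] at h1
  filter_upwards [(tendsto_order.1 h1).2 1 zero_lt_one] with n hn
  refine lt_of_le_of_lt (csInf_le luxemburg_bddBelow ⟨hl, ?_⟩) (half_lt_self ha)
  refine le_trans ?_ hn.le
  rw [modular_eq, modular_eq, ← lintegral_const_mul' _ _ ENNReal.ofReal_ne_top]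
  refine lintegral_mono fun z => ?_
  unfold modularDensity
  rw [← ENNReal.ofReal_mul hC, ← mul_div_assoc]
  apply ENNReal.ofReal_le_ofReal
  apply div_le_div_of_nonneg_right _ (by positivity)
  simp only [div_eq_inv_mul (u n _) (a / 2)]
  rw [holderQuot_mul, abs_of_nonneg (inv_nonneg.2 hl.le)]
  exact hC' _ (holderQuot_nonneg z)

/-- By convexity and `G 0 = 0`, dividing `u` by `1 + ρ(u)` divides the modular by at least as much,
so `1 + ρ(u)` is admissible. -/
lemma luxemburg_le_one_add {u : E N → ℝ} (hu : modular s Y u < ∞) :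
    luxemburg s Y u ≤ 1 + (modular s Y u).toReal := by
  set M := (modular s Y u).toReal
  have hM : 0 ≤ M := ENNReal.toReal_nonneg
  apply csInf_le luxemburg_bddBelow
  refine ⟨by positivity, ?_⟩
  have e : (fun x => u x / (1 + M)) = fun x => (1 + M)⁻¹ * u x := by
    ext x; rw [div_eq_inv_mul]
  rw [e]
  refine (modular_shrink (by positivity) (inv_le_one_of_one_le₀ (by linarith))).trans ?_
  rw [← ENNReal.ofReal_toReal hu.ne, ← ENNReal.ofReal_mul (by positivity), ← ENNReal.ofReal_one]
  apply ENNReal.ofReal_le_ofReal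
  rw [inv_mul_le_iff₀ (by positivity)]
  change M ≤ _
  linarith

end Density

/-! ### Uniform bounds for radially non-decreasing functions -/

section Radial

variable {N : ℕ}

/-- A monotone function has countably many discontinuities, and each corresponds to a sphere, a null
set in positive dimension. This turns Helly's conclusion into a.e. convergence on `ℝᴺ`. -/
lemma ae_continuousAt_norm [Nontrivial (E N)] {g : ℝ → ℝ} (hg : Monotone g) :
    ∀ᵐ x ∂(volume : Measure (E N)), ContinuousAt g ‖x‖ := by
  have hc := hg.countable_not_continuousAt
  have hs : {x : E N | ¬ContinuousAt g ‖x‖} ⊆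
      ⋃ r ∈ {r | ¬ContinuousAt g r}, Metric.sphere (0 : E N) r := by
    intro x hx
    simp only [mem_iUnion]
    exact ⟨‖x‖, hx, by simp⟩
  exact measure_mono_null hs ((measure_biUnion_null_iff hc).2 fun r _ =>
    Measure.addHaar_sphere volume 0 r)

/-- The open annulus `{R < |x| < R'}`. -/
def annulus (N : ℕ) (R R' : ℝ) : Set (E N) := {x | R < ‖x‖ ∧ ‖x‖ < R'}

lemma isOpen_annulus (R R' : ℝ) : IsOpen (annulus N R R') :=
  (isOpen_lt continuous_const continuous_norm).inter (isOpen_lt continuous_norm continuous_const)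

lemma annulus_measure_pos [Nontrivial (E N)] {R R' : ℝ} (hR : 0 ≤ R) (h : R < R') :
    0 < volume (annulus N R R') := by
  refine (isOpen_annulus R R').measure_pos volume ?_
  obtain ⟨x, hx⟩ := exists_norm_eq (E N) (c := (R + R') / 2) (by linarith)
  exact ⟨x, by constructor <;> rw [hx] <;> linarith⟩

lemma annulus_measure_lt_top (R R' : ℝ) : volume (annulus N R R') < ∞ :=
  (measure_mono (fun x hx => by simpa using hx.2 : annulus N R R' ⊆ Metric.ball 0 R')).trans_lt
    measure_ball_lt_top

/-- A non-decreasing radial function is bounded inside `B₁` by its `L²(B₁)` norm. -/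
lemma exists_half_bound [Nontrivial (E N)] (C : ℝ) : ∃ M : ℝ, ∀ f : ℝ → ℝ, Monotone f →
    (∀ r, 0 ≤ f r) → MemLp (fun x : E N => f ‖x‖) 2 (volume.restrict (B₁ N)) →
    ∫ x in B₁ N, |f ‖x‖| ^ 2 ≤ C → f (1 / 2) ≤ M := by
  set m := (volume (annulus N (1 / 2) 1)).toReal
  have hm : 0 < m := ENNReal.toReal_pos (annulus_measure_pos (by norm_num) (by norm_num)).ne'
    (annulus_measure_lt_top _ _).ne
  -- On the annulus `1/2 < |x| < 1` the profile is at least `f (1/2)`, so `f (1/2)² ≤ C / m`; then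
  -- `t ≤ 1 + t²`.
  refine ⟨1 + C / m, fun f hf hf0 hL hC => ?_⟩
  have hint : IntegrableOn (fun x : E N => |f ‖x‖| ^ 2) (B₁ N) := by
    exact hL.integrable_norm_pow two_ne_zero
  have hsub : annulus N (1 / 2) 1 ⊆ B₁ N := fun x hx => by simpa [B₁] using hx.2
  have h1 : ∫ _ in annulus N (1 / 2) 1, f (1 / 2) ^ 2 ≤ ∫ x in B₁ N, |f ‖x‖| ^ 2 := by
    refine le_trans (setIntegral_mono_on (integrableOn_const (annulus_measure_lt_top _ _).ne)
      (hint.mono_set hsub) (isOpen_annulus _ _).measurableSet fun x hx => ?_)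
      (setIntegral_mono_set hint (ae_of_all _ fun x => by positivity) hsub.eventuallyLE)
    rw [abs_of_nonneg (hf0 _)]
    exact pow_le_pow_left₀ (hf0 _) (hf hx.1.le) 2
  rw [setIntegral_const, smul_eq_mul] at h1
  change m * _ ≤ _ at h1
  have h2 : f (1 / 2) ^ 2 ≤ C / m := by
    rw [le_div_iff₀ hm]; linarith
  nlinarith [hf0 (1 / 2)]

/-- The modular and the `L²(B₁)` norm bound radially non-decreasing functions locally uniformly
on the whole of `ℝᴺ`, because the modular sees the increments between `B₁` and its complement. -/
lemma exists_radial_bound [Nontrivial (E N)] {s : ℝ} (hs : 0 < s) (Y : YoungFunction) (C R : ℝ)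
    (hR : 1 ≤ R) : ∃ M : ℝ, ∀ f : ℝ → ℝ, Monotone f → (∀ r, 0 ≤ f r) →
    MemLp (fun x : E N => f ‖x‖) 2 (volume.restrict (B₁ N)) →
    ∫ x in B₁ N, |f ‖x‖| ^ 2 ≤ C →
    modular s Y (fun x : E N => f ‖x‖) ≤ ENNReal.ofReal C → f R ≤ M := by
  obtain ⟨M₀, hM₀⟩ := exists_half_bound (N := N) C
  -- On `A ⊆ Q` the increment is at least `f R - f (1/2)`, and the distance is positive and at most
  -- `R + 2`. The integrand is thus bounded below on a set of positive measure.
  set A := Metric.ball (0 : E N) (1 / 2) ×ˢ annulus N R (R + 1)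
  have hAvol : volume A = volume (Metric.ball (0 : E N) (1 / 2)) * volume (annulus N R (R + 1)) :=
    Measure.prod_prod _ _
  have hAmeas : MeasurableSet A :=
    Metric.isOpen_ball.measurableSet.prod (isOpen_annulus _ _).measurableSet
  set m := (volume A).toReal
  have hAfin : volume A ≠ ∞ := by
    rw [hAvol]
    exact ENNReal.mul_ne_top measure_ball_lt_top.ne (annulus_measure_lt_top _ _).ne
  have hm : 0 < m := by
    apply ENNReal.toReal_pos _ hAfin
    rw [hAvol]
    exact mul_ne_zero (Metric.measure_ball_pos _ _ (by norm_num)).ne'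
      (annulus_measure_pos (by linarith) (by linarith)).ne'
  have hAQ : A ⊆ Q N := by
    rintro z ⟨hz, -⟩ ⟨hz', -⟩
    apply hz'
    exact Metric.ball_subset_ball (by norm_num) hz
  set d := R + 2
  have hd : 0 < d := by simp only [d]; linarith
  refine ⟨max M₀ (M₀ + (1 + max C 0 * d ^ N / m / Y.g 1) * d ^ s), ?_⟩
  intro f hf hf0 hL hC hρ
  have hhalf := hM₀ f hf hf0 hL hC
  set t := (f R - f (1 / 2)) / d ^ s
  have hds : 0 < d ^ s := Real.rpow_pos_of_pos hd s
  have ht : 0 ≤ t := div_nonneg (sub_nonneg.2 (hf (by linarith))) hds.le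
  have hdens : ∀ z ∈ A, ENNReal.ofReal (Y.G t / d ^ N) ≤
      modularDensity s Y (fun x : E N => f ‖x‖) z := by
    rintro z ⟨hz1, hz2, hz3⟩
    have hz1 : ‖z.1‖ < 1 / 2 := by simpa using hz1
    have hn : 0 < ‖z.1 - z.2‖ := by
      have := norm_sub_norm_le z.2 z.1
      rw [norm_sub_rev]
      linarith
    have hn' : ‖z.1 - z.2‖ ≤ d := by
      have := norm_sub_le z.1 z.2
      simp only [d]
      linarith
    have hns := Real.rpow_pos_of_pos hn s
    have hq : t ≤ holderQuot s (fun x : E N => f ‖x‖) z := by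
      apply div_le_div₀ (abs_nonneg _) _ hns (Real.rpow_le_rpow hn.le hn' hs.le)
      rw [abs_sub_comm]
      exact le_trans (sub_le_sub (hf hz2.le) (hf hz1.le)) (le_abs_self _)
    apply ENNReal.ofReal_le_ofReal
    apply div_le_div₀ (Y.G_nonneg (ht.trans hq)) (Y.G_mono ht hq) (by positivity)
    exact pow_le_pow_left₀ hn.le hn' N
  have h1 : ENNReal.ofReal (Y.G t / d ^ N) * volume A ≤ ENNReal.ofReal C := by
    rw [← setLIntegral_const]
    exact (setLIntegral_mono' hAmeas hdens).trans ((lintegral_mono_set hAQ).trans hρ)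
  rw [← ENNReal.ofReal_toReal hAfin, ← ENNReal.ofReal_mul
    (div_nonneg (Y.G_nonneg ht) (by positivity))] at h1
  have h2 : Y.G t / d ^ N * m ≤ max C 0 := by
    rw [← ENNReal.ofReal_le_ofReal_iff (le_max_right _ _)]
    exact h1.trans (ENNReal.ofReal_le_ofReal (le_max_left _ _))
  have h3 : Y.G t ≤ max C 0 * d ^ N / m := by
    rw [le_div_iff₀ hm]
    rw [div_mul_eq_mul_div, div_le_iff₀ (by positivity)] at h2
    exact h2
  have h4 := Y.le_of_G_le ht h3
  apply le_max_of_le_right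
  rw [div_le_iff₀ hds] at h4
  linarith

end Radial

/-! ### Integrals of powers and convergence in `L^q` -/

lemma integral_abs_rpow {α : Type*} [MeasurableSpace α] {μ : Measure α} {q : ℝ} (hq : 0 < q)
    {f : α → ℝ} (hf : MemLp f (ENNReal.ofReal q) μ) :
    ∫ x, |f x| ^ q ∂μ = (eLpNorm f (ENNReal.ofReal q) μ).toReal ^ q := by
  have h0 : 0 ≤ ∫ x, |f x| ^ q ∂μ := integral_nonneg fun x => by positivity
  rw [hf.eLpNorm_eq_integral_rpow_norm (by simpa using hq) ENNReal.ofReal_ne_top,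
    ENNReal.toReal_ofReal hq.le, ENNReal.toReal_ofReal (by positivity)]
  simp only [Real.norm_eq_abs]
  rw [Real.rpow_inv_rpow h0 hq.ne']

lemma integrable_abs_rpow {α : Type*} [MeasurableSpace α] {μ : Measure α} {q : ℝ} (hq : 0 < q)
    {f : α → ℝ} (hf : MemLp f (ENNReal.ofReal q) μ) : Integrable (fun x => |f x| ^ q) μ := by
  have := hf.integrable_norm_rpow (by simpa using hq) ENNReal.ofReal_ne_top
  simpa [ENNReal.toReal_ofReal hq.le] using this

/-- Bounded convergence in `L^q`. -/
lemma tendsto_eLpNorm_zero_of_bounded {α : Type*} [MeasurableSpace α] {μ : Measure α}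
    [IsFiniteMeasure μ] {q : ℝ} (hq : 0 < q) {f : ℕ → α → ℝ} {M : ℝ}
    (hf : ∀ n, MemLp (f n) (ENNReal.ofReal q) μ) (hM : ∀ n, ∀ᵐ x ∂μ, |f n x| ≤ M)
    (h : ∀ᵐ x ∂μ, Tendsto (fun n => f n x) atTop (𝓝 0)) :
    Tendsto (fun n => (eLpNorm (f n) (ENNReal.ofReal q) μ).toReal) atTop (𝓝 0) := by
  have h1 : Tendsto (fun n => ∫ x, |f n x| ^ q ∂μ) atTop (𝓝 (∫ _, (0 : ℝ) ∂μ)) := by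
    apply tendsto_integral_of_dominated_convergence (fun _ => M ^ q)
      (fun n => (integrable_abs_rpow hq (hf n)).1) (integrable_const _)
    · intro n
      filter_upwards [hM n] with x hx
      rw [Real.norm_eq_abs, abs_of_nonneg (by positivity)]
      exact Real.rpow_le_rpow (abs_nonneg _) hx hq.le
    · filter_upwards [h] with x hx
      have := hx.abs.rpow_const (p := q) (Or.inr hq.le)
      rwa [abs_zero, Real.zero_rpow hq.ne'] at this
  have h2 := h1.rpow_const (p := q⁻¹) (Or.inr (inv_nonneg.2 hq.le))
  simp only [integral_zero, Real.zero_rpow (inv_pos.2 hq).ne'] at h2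
  refine h2.congr fun n => ?_
  rw [integral_abs_rpow hq (hf n), Real.rpow_rpow_inv ENNReal.toReal_nonneg hq.ne']

instance isFiniteMeasure_restrict_B₁ (N : ℕ) :
    IsFiniteMeasure ((volume : Measure (E N)).restrict (B₁ N)) :=
  ⟨by rw [Measure.restrict_apply_univ]; exact measure_ball_lt_top⟩

/-! ### Estimates in `V` and the structure of the cone -/

section Space

variable {N : ℕ} {s p : ℝ} {Y : YoungFunction} [Y.Growth]

lemma V.integral_sq (u : V N s p Y) :
    ∫ x in B₁ N, |u.fn x| ^ 2 = (eLpNorm u.fn 2 (volume.restrict (B₁ N))).toReal ^ 2 := by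
  have h2 : ENNReal.ofReal 2 = 2 := by simp
  have h := integral_abs_rpow (q := 2) zero_lt_two (f := u.fn)
    (μ := volume.restrict (B₁ N)) (by rw [h2]; exact u.memLp_two)
  rw [h2] at h
  simpa only [Real.rpow_two] using h

lemma V.integral_rpow (hp0 : 0 < p) (u : V N s p Y) :
    ∫ x in B₁ N, |u.fn x| ^ p =
      (eLpNorm u.fn (ENNReal.ofReal p) (volume.restrict (B₁ N))).toReal ^ p :=
  integral_abs_rpow hp0 u.memLp

lemma V.eLpNorm_two_le (u : V N s p Y) :
    (eLpNorm u.fn 2 (volume.restrict (B₁ N))).toReal ≤ ‖u‖ := by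
  rw [V.norm_def]
  have := luxemburg_nonneg (s := s) (Y := Y) (u := u.fn)
  have := ENNReal.toReal_nonneg
    (a := eLpNorm u.fn (ENNReal.ofReal p) (volume.restrict (B₁ N)))
  linarith

lemma V.eLpNorm_le (u : V N s p Y) :
    (eLpNorm u.fn (ENNReal.ofReal p) (volume.restrict (B₁ N))).toReal ≤ ‖u‖ := by
  rw [V.norm_def]
  have := luxemburg_nonneg (s := s) (Y := Y) (u := u.fn)
  have := ENNReal.toReal_nonneg (a := eLpNorm u.fn 2 (volume.restrict (B₁ N)))
  linarith

lemma V.integrable_rpow (hp0 : 0 < p) (u : V N s p Y) :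
    IntegrableOn (fun x => |u.fn x| ^ p) (B₁ N) :=
  integrable_abs_rpow hp0 u.memLp

lemma V.integrable_sq (u : V N s p Y) : IntegrableOn (fun x => u.fn x ^ 2) (B₁ N) := by
  have := u.memLp_two.integrable_norm_pow two_ne_zero
  simp only [Real.norm_eq_abs, sq_abs] at this
  exact this

lemma V.integrable (u : V N s p Y) : IntegrableOn u.fn (B₁ N) :=
  u.memLp_two.integrable one_le_two

lemma V.integral_abs_le (u : V N s p Y) :
    ∫ x in B₁ N, |u.fn x| ≤ (1 + (volume (B₁ N)).toReal) *
      (eLpNorm u.fn 2 (volume.restrict (B₁ N))).toReal := by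
  set a := (eLpNorm u.fn 2 (volume.restrict (B₁ N))).toReal
  set m := (volume (B₁ N)).toReal
  have hm : 0 ≤ m := ENNReal.toReal_nonneg
  have ha : 0 ≤ a := ENNReal.toReal_nonneg
  -- Young's inequality `|u| ≤ c/2 + u²/(2c)`, used with `c = a`, or with `c → 0` when `a = 0`.
  have hbound : ∀ c : ℝ, 0 < c → ∫ x in B₁ N, |u.fn x| ≤ (c * m + c⁻¹ * a ^ 2) / 2 := by
    intro c hc
    have h1 : ∫ x in B₁ N, |u.fn x| ≤ ∫ x in B₁ N, (c / 2 + c⁻¹ / 2 * u.fn x ^ 2) := by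
      apply integral_mono u.integrable.abs ((integrable_const _).add (u.integrable_sq.const_mul _))
      intro x
      have h2 : 0 ≤ c⁻¹ * (|u.fn x| - c) ^ 2 := by positivity
      have h3 : c⁻¹ * (|u.fn x| - c) ^ 2 = c⁻¹ * u.fn x ^ 2 - 2 * |u.fn x| + c := by
        rw [sub_sq, sq_abs]; field_simp
      change |u.fn x| ≤ c / 2 + c⁻¹ / 2 * u.fn x ^ 2
      linarith
    rw [integral_add (integrable_const _) (u.integrable_sq.const_mul _), integral_const_mul,
      setIntegral_const, smul_eq_mul] at h1
    have h4 := u.integral_sq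
    simp only [sq_abs] at h4
    rw [h4] at h1
    change _ ≤ m * (c / 2) + c⁻¹ / 2 * a ^ 2 at h1
    linarith
  rcases ha.eq_or_lt with h0 | h0
  · rw [← h0, mul_zero]
    apply le_of_forall_pos_le_add
    intro ε hε
    have := hbound (ε / (m + 1)) (by positivity)
    rw [← h0] at this
    have h5 : ε / (m + 1) * m ≤ ε := by
      rw [div_mul_eq_mul_div, div_le_iff₀ (by positivity)]; nlinarith
    simp only [ne_eq, OfNat.ofNat_ne_zero, not_false_eq_true, zero_pow, mul_zero] at this
    linarith
  · have := hbound a h0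
    have e : a⁻¹ * a ^ 2 = a := by field_simp
    rw [e] at this
    nlinarith [mul_nonneg ha hm]

lemma V.fn_sub (u v : V N s p Y) : (u - v).fn =ᵐ[volume] fun x => u.fn x - v.fn x :=
  AEEqFun.coeFn_sub u.1 v.1

lemma modular_toReal_le_Psi (u : V N s p Y) : (modular s Y u.fn).toReal ≤ Psi u := by
  have : 0 ≤ ∫ x in B₁ N, |u.fn x| ^ 2 := integral_nonneg fun x => by positivity
  unfold Psi
  linarith

lemma integral_sq_le_Psi (u : V N s p Y) : ∫ x in B₁ N, |u.fn x| ^ 2 ≤ 2 * Psi u := by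
  have : 0 ≤ (modular s Y u.fn).toReal := ENNReal.toReal_nonneg
  unfold Psi
  linarith

lemma Psi_nonneg (u : V N s p Y) : 0 ≤ Psi u :=
  ENNReal.toReal_nonneg.trans (modular_toReal_le_Psi u)

/-- The norm is controlled by the two functionals. -/
lemma V.norm_le (hp2 : 2 < p) (u : V N s p Y) : ‖u‖ ≤ 3 + 3 * Psi u + p * Phi u := by
  have h1 := modular_toReal_le_Psi u
  have h2 := integral_sq_le_Psi u
  have h3 := luxemburg_le_one_add u.modular_lt_top
  rw [u.integral_sq] at h2
  have h4 : p * Phi u = (eLpNorm u.fn (ENNReal.ofReal p) (volume.restrict (B₁ N))).toReal ^ p := by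
    rw [Phi, u.integral_rpow (by linarith)]
    field_simp
  rw [V.norm_def, h4]
  set a := (eLpNorm u.fn 2 (volume.restrict (B₁ N))).toReal
  set b := (eLpNorm u.fn (ENNReal.ofReal p) (volume.restrict (B₁ N))).toReal
  have hb : 0 ≤ b := ENNReal.toReal_nonneg
  have h5 : b ≤ 1 + b ^ p := by
    rcases le_total b 1 with h | h
    · have : 0 ≤ b ^ p := by positivity
      linarith
    · have := Real.rpow_le_rpow_of_exponent_le h (by linarith : (1 : ℝ) ≤ p)
      rw [Real.rpow_one] at this
      linarith
  nlinarith [sq_nonneg (a - 1 / 2)]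

/-- Dilations of an element increase `Ψ` by at most the factor for `G`. -/
lemma Psi_dilation_le {κ r : ℝ} (hr : 0 < r) (hκ : 2 + r ≤ κ)
    (hG : ∀ t, 0 ≤ t → Y.G ((1 + r) * t) ≤ (1 + κ * r) * Y.G t) (u : V N s p Y) :
    Psi ((1 + r) • u) ≤ (1 + κ * r) * Psi u := by
  have hκr : 0 ≤ 1 + κ * r := by nlinarith
  have h1 : modular s Y ((1 + r) • u).fn ≤ ENNReal.ofReal (1 + κ * r) * modular s Y u.fn := by
    rw [modular_congr (V.fn_smul _ u), modular_eq, modular_eq,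
      ← lintegral_const_mul' _ _ ENNReal.ofReal_ne_top]
    refine lintegral_mono fun z => ?_
    unfold modularDensity
    rw [← ENNReal.ofReal_mul hκr, holderQuot_mul, ← mul_div_assoc,
      abs_of_nonneg (by linarith : 0 ≤ 1 + r)]
    apply ENNReal.ofReal_le_ofReal
    apply div_le_div_of_nonneg_right _ (by positivity)
    exact hG _ (holderQuot_nonneg z)
  have h2 := ENNReal.toReal_mono (ENNReal.mul_ne_top ENNReal.ofReal_ne_top u.modular_lt_top.ne) h1
  rw [ENNReal.toReal_mul, ENNReal.toReal_ofReal hκr] at h2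
  have h3 : ∫ x in B₁ N, |((1 + r) • u).fn x| ^ 2 = (1 + r) ^ 2 * ∫ x in B₁ N, |u.fn x| ^ 2 := by
    rw [← integral_const_mul]
    apply integral_congr_ae
    filter_upwards [ae_restrict_of_ae (V.fn_smul (1 + r) u)] with x hx
    simp only [hx, sq_abs, mul_pow]
  have h4 : 0 ≤ ∫ x in B₁ N, |u.fn x| ^ 2 := integral_nonneg fun x => by positivity
  have h5 : (1 + r) ^ 2 ≤ 1 + κ * r := by nlinarith
  have h6 := mul_le_mul_of_nonneg_right h5 h4
  unfold Psi
  rw [h3]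
  linarith

/-- Elements of the cone have nonnegative profiles that are monotone on the whole line. -/
lemma mem_K_iff {u : V N s p Y} : u ∈ K N s p Y ↔ ∃ f : ℝ → ℝ, Monotone f ∧ (∀ r, 0 ≤ f r) ∧
    u.fn =ᵐ[volume] fun x => f ‖x‖ := by
  constructor
  · rintro ⟨h0, f, hf, hu⟩
    -- The profile is extended by its value at `0` to negative radii, and its positive part is
    -- taken; nonnegativity of `u` makes the latter harmless a.e.
    refine ⟨fun r => max (f (max r 0)) 0, fun a b hab => ?_, fun r => le_max_right _ _, ?_⟩
    · exact max_le_max_right 0 (hf (mem_Ici.2 (le_max_right a 0)) (mem_Ici.2 (le_max_right b 0))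
        (max_le_max_right 0 hab))
    · filter_upwards [h0, hu] with x h1 h2
      rw [max_eq_left (norm_nonneg x), ← h2, max_eq_left h1]
  · rintro ⟨f, hf, hf0, hu⟩
    refine ⟨?_, f, hf.monotoneOn _, hu⟩
    filter_upwards [hu] with x hx
    rw [hx]
    exact hf0 _

lemma exists_bound_of_mem_K {u : V N s p Y} (hu : u ∈ K N s p Y) :
    ∃ M, ∀ᵐ x ∂volume.restrict (B₁ N), u.fn x ≤ M := by
  obtain ⟨f, hf, -, h⟩ := mem_K_iff.1 hu
  refine ⟨f 1, ?_⟩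
  filter_upwards [ae_restrict_of_ae h, ae_restrict_mem (show MeasurableSet (B₁ N) from
    Metric.isOpen_ball.measurableSet)] with x h1 hx
  rw [h1]
  exact hf (mem_ball_zero_iff.1 hx).le

lemma zero_mem_K : (0 : V N s p Y) ∈ K N s p Y :=
  mem_K_iff.2 ⟨fun _ => 0, monotone_const, fun _ => le_rfl, V.fn_zero⟩

lemma smul_mem_K {c : ℝ} (hc : 0 ≤ c) {u : V N s p Y} (hu : u ∈ K N s p Y) :
    c • u ∈ K N s p Y := by
  obtain ⟨f, hf, hf0, h⟩ := mem_K_iff.1 hu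
  refine mem_K_iff.2 ⟨fun r => c * f r, hf.const_mul hc, fun r => mul_nonneg hc (hf0 r), ?_⟩
  filter_upwards [V.fn_smul c u, h] with x h1 h2
  rw [h1, h2]

/-- A bounded monotone radial function with finite modular defines an element of the cone. -/
lemma exists_mem_K {f : ℝ → ℝ} (hf : Monotone f) (hf0 : ∀ r, 0 ≤ f r)
    (h : modular s Y (fun x : E N => f ‖x‖) < ∞) :
    ∃ u ∈ K N s p Y, u.fn =ᵐ[volume] fun x => f ‖x‖ := by
  have hm : AEStronglyMeasurable (fun x : E N => f ‖x‖) volume :=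
    (hf.measurable.comp measurable_norm).aestronglyMeasurable
  have he : (AEEqFun.mk _ hm : E N → ℝ) =ᵐ[volume] fun x => f ‖x‖ := AEEqFun.coeFn_mk _ hm
  have hL : ∀ q : ℝ≥0∞, MemLp (AEEqFun.mk _ hm : E N → ℝ) q (volume.restrict (B₁ N)) := by
    intro q
    rw [memLp_congr_ae (ae_restrict_of_ae he)]
    apply MemLp.of_bound hm.restrict (f 1)
    filter_upwards [ae_restrict_mem (show MeasurableSet (B₁ N) from
      Metric.isOpen_ball.measurableSet)] with x hx
    rw [Real.norm_eq_abs, abs_of_nonneg (hf0 _)]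
    exact hf (by simpa [B₁] using (mem_ball_zero_iff.1 hx).le)
  refine ⟨⟨AEEqFun.mk _ hm, hL 2, (modular_congr he).trans_lt h, ⟨f, he⟩, hL _⟩, ?_, he⟩
  exact mem_K_iff.2 ⟨f, hf, hf0, he⟩

end Space

/-! ### The derivative of `Φ` at bounded nonnegative functions -/

section Derivative

variable {N : ℕ} {s p : ℝ} {Y : YoungFunction} [Y.Growth] [hp : Fact (2 < p)]

lemma V.integrable_rpow_mul {u : V N s p Y} {M : ℝ} (h0 : ∀ᵐ x ∂volume, 0 ≤ u.fn x)
    (hM : ∀ᵐ x ∂volume.restrict (B₁ N), u.fn x ≤ M) (h : V N s p Y) :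
    IntegrableOn (fun x => u.fn x ^ (p - 1) * h.fn x) (B₁ N) := by
  apply h.integrable.bdd_mul (c := M ^ (p - 1)) (u.measurable_fn.pow_const _).aestronglyMeasurable
  filter_upwards [ae_restrict_of_ae h0, hM] with x h1 h2
  rw [Real.norm_eq_abs, abs_of_nonneg (by positivity)]
  exact Real.rpow_le_rpow h1 h2 (by linarith [hp.out])

lemma V.abs_integral_rpow_mul_le {u : V N s p Y} {M : ℝ} (h0 : ∀ᵐ x ∂volume, 0 ≤ u.fn x)
    (hM : ∀ᵐ x ∂volume.restrict (B₁ N), u.fn x ≤ M) (h : V N s p Y) :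
    |∫ x in B₁ N, u.fn x ^ (p - 1) * h.fn x| ≤ M ^ (p - 1) * ∫ x in B₁ N, |h.fn x| := by
  rw [← integral_const_mul, ← Real.norm_eq_abs]
  refine norm_integral_le_of_norm_le (h.integrable.abs.const_mul _) ?_
  filter_upwards [ae_restrict_of_ae h0, hM] with x h1 h2
  rw [Real.norm_eq_abs, abs_mul, abs_of_nonneg (Real.rpow_nonneg h1 _)]
  gcongr
  linarith [hp.out]

/-- `Φ` is Fréchet differentiable at nonnegative functions that are bounded on `B₁`. -/
lemma fderiv_Phi {u : V N s p Y} {M : ℝ} (h0 : ∀ᵐ x ∂volume, 0 ≤ u.fn x)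
    (hM : ∀ᵐ x ∂volume.restrict (B₁ N), u.fn x ≤ M) (h : V N s p Y) :
    fderiv ℝ (Phi : V N s p Y → ℝ) u h = ∫ x in B₁ N, u.fn x ^ (p - 1) * h.fn x := by
  have hp2 := hp.out
  have hM0 : 0 ≤ max M 0 := le_max_right _ _
  have hM' : ∀ᵐ x ∂volume.restrict (B₁ N), u.fn x ≤ max M 0 := by
    filter_upwards [hM] with x hx using hx.trans (le_max_left _ _)
  let L₀ : V N s p Y →ₗ[ℝ] ℝ :=
    { toFun := fun h => ∫ x in B₁ N, u.fn x ^ (p - 1) * h.fn x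
      map_add' := by
        intro h k
        rw [← integral_add (V.integrable_rpow_mul h0 hM h) (V.integrable_rpow_mul h0 hM k)]
        apply integral_congr_ae
        filter_upwards [ae_restrict_of_ae (V.fn_add h k)] with x hx
        rw [hx, mul_add]
      map_smul' := by
        intro c h
        simp only [RingHom.id_apply, smul_eq_mul]
        rw [← integral_const_mul]
        apply integral_congr_ae
        filter_upwards [ae_restrict_of_ae (V.fn_smul c h)] with x hx
        rw [hx]
        ring }
  -- Boundedness of `u` reduces continuity to `L¹(B₁)`, hence to `L²(B₁)`.
  let L : V N s p Y →L[ℝ] ℝ := L₀.mkContinuous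
    (max M 0 ^ (p - 1) * (1 + (volume (B₁ N)).toReal)) (by
      intro h
      refine (V.abs_integral_rpow_mul_le h0 hM' h).trans ?_
      rw [mul_assoc]
      have h1 := h.integral_abs_le.trans (mul_le_mul_of_nonneg_left h.eLpNorm_two_le
        (by positivity))
      exact mul_le_mul_of_nonneg_left h1 (by positivity))
  set C := p * (p - 1) * (max M 0 + 1) ^ (p - 2) + (2 + p)
  have hC : 0 ≤ C := by
    have : 0 ≤ p - 1 := by linarith
    positivity
  -- The pointwise remainder integrates to the `L²` and `Lᵖ` parts of the norm; both exponents
  -- exceed `1`, so the bound is `o(‖k‖)`.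
  have hrem : ∀ k : V N s p Y,
      |Phi (u + k) - Phi u - L k| ≤ C / p * (‖k‖ ^ 2 + ‖k‖ ^ p) := by
    intro k
    have hLk : L k = 1 / p * ∫ x in B₁ N, p * (u.fn x ^ (p - 1) * k.fn x) := by
      rw [integral_const_mul, ← mul_assoc, one_div, inv_mul_cancel₀ (by linarith), one_mul]
      rfl
    have hi := (V.integrable_rpow_mul h0 hM k).const_mul p
    have hp0 : 0 < p := by linarith
    have e : Phi (u + k) - Phi u - L k = 1 / p * ∫ x in B₁ N,
        (|(u + k).fn x| ^ p - |u.fn x| ^ p - p * (u.fn x ^ (p - 1) * k.fn x)) := by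
      have hd : IntegrableOn (fun x => |(u + k).fn x| ^ p - |u.fn x| ^ p) (B₁ N) :=
        ((u + k).integrable_rpow hp0).sub (u.integrable_rpow hp0)
      rw [hLk, integral_sub hd hi,
        integral_sub ((u + k).integrable_rpow hp0) (u.integrable_rpow hp0)]
      unfold Phi
      ring
    have hb : |∫ x in B₁ N,
        (|(u + k).fn x| ^ p - |u.fn x| ^ p - p * (u.fn x ^ (p - 1) * k.fn x))| ≤
        ∫ x in B₁ N, C * (k.fn x ^ 2 + |k.fn x| ^ p) := by
      have hd : IntegrableOn (fun x => C * (k.fn x ^ 2 + |k.fn x| ^ p)) (B₁ N) :=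
        (k.integrable_sq.add (k.integrable_rpow hp0)).const_mul C
      rw [← Real.norm_eq_abs]
      refine norm_integral_le_of_norm_le hd ?_
      filter_upwards [ae_restrict_of_ae h0, hM', ae_restrict_of_ae (V.fn_add u k)] with x h1 h2 h3
      rw [h3, ← mul_assoc, Real.norm_eq_abs]
      exact abs_rpow_remainder_le hp2 h1 h2
    have hs := k.integral_sq
    simp only [sq_abs] at hs
    rw [integral_const_mul, integral_add k.integrable_sq (k.integrable_rpow hp0), hs,
      k.integral_rpow hp0] at hb
    rw [e, abs_mul, abs_of_nonneg (by positivity : 0 ≤ 1 / p), div_mul_eq_mul_div, one_mul,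
      div_mul_eq_mul_div]
    apply div_le_div_of_nonneg_right _ hp0.le
    refine hb.trans ?_
    have h4 := pow_le_pow_left₀ ENNReal.toReal_nonneg k.eLpNorm_two_le 2
    have h5 := Real.rpow_le_rpow ENNReal.toReal_nonneg k.eLpNorm_le hp0.le
    exact mul_le_mul_of_nonneg_left (add_le_add h4 h5) hC
  have hL : HasFDerivAt (Phi : V N s p Y → ℝ) L u := by
    rw [hasFDerivAt_iff_isLittleO_nhds_zero, Asymptotics.isLittleO_iff]
    intro c hc
    have hcont : Tendsto (fun k : V N s p Y => C / p * (‖k‖ + ‖k‖ ^ (p - 1))) (𝓝 0) (𝓝 0) := by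
      have h1 : Tendsto (fun k : V N s p Y => ‖k‖) (𝓝 0) (𝓝 0) := tendsto_norm_zero
      have h2 := (h1.add (h1.rpow_const (p := p - 1) (Or.inr (by linarith)))).const_mul (C / p)
      rwa [Real.zero_rpow (by linarith), add_zero, mul_zero] at h2
    filter_upwards [(tendsto_order.1 hcont).2 c hc] with k hk
    refine (hrem k).trans ?_
    rcases (norm_nonneg k).eq_or_lt with h1 | h1
    · rw [← h1, Real.zero_rpow (by linarith)]; simp
    · have e : ‖k‖ ^ p = ‖k‖ ^ (p - 1) * ‖k‖ := by
        rw [← Real.rpow_add_one h1.ne']; ring_nf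
      rw [e, show C / p * (‖k‖ ^ 2 + ‖k‖ ^ (p - 1) * ‖k‖) =
        C / p * (‖k‖ + ‖k‖ ^ (p - 1)) * ‖k‖ by ring]
      exact mul_le_mul_of_nonneg_right hk.le h1.le
  rw [hL.fderiv]
  rfl

/-- Euler's identity for the homogeneous functional `Φ`. -/
lemma fderiv_Phi_self {u : V N s p Y} {M : ℝ} (h0 : ∀ᵐ x ∂volume, 0 ≤ u.fn x)
    (hM : ∀ᵐ x ∂volume.restrict (B₁ N), u.fn x ≤ M) :
    fderiv ℝ (Phi : V N s p Y → ℝ) u u = p * Phi u := by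
  have hp2 := hp.out
  have hp0 : p ≠ 0 := by linarith
  rw [fderiv_Phi h0 hM, Phi, ← mul_assoc, mul_one_div_cancel hp0, one_mul]
  apply integral_congr_ae
  filter_upwards [ae_restrict_of_ae h0] with x hx
  rw [abs_of_nonneg hx]
  rcases hx.eq_or_lt with h | h
  · rw [← h, Real.zero_rpow hp0, mul_zero]
  · rw [← Real.rpow_add_one h.ne']; ring_nf

end Derivative

/-! ### Boundedness and compactness of Palais–Smale sequences -/

section Compactness

variable {N : ℕ} {s p : ℝ} {Y : YoungFunction} [Y.Growth] [hp : Fact (2 < p)]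

/-- Palais–Smale sequences in the cone are bounded. -/
lemma eventually_bounded {u : ℕ → V N s p Y} {ε : ℕ → ℝ} {c : ℝ}
    (hqm : 2 ≤ Y.qMinus) (hqp : Y.qPlus < p) (hK : ∀ n, u n ∈ K N s p Y)
    (hc : Tendsto (fun n => Psi (u n) - Phi (u n)) atTop (𝓝 c)) (hε : Tendsto ε atTop (𝓝 0))
    (h : ∀ n, ∀ v ∈ K N s p Y, Psi (u n) ≤
      Psi v + (fderiv ℝ (Phi : V N s p Y → ℝ) (u n) (u n - v) + ε n * ‖u n - v‖)) :
    ∃ C, ∀ᶠ n in atTop, Psi (u n) ≤ C ∧ ‖u n‖ ≤ C := by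
  have hp2 := hp.out
  obtain ⟨κ, r, hκ, hr, hrκ, hG⟩ := Y.exists_dilation hqm hqp
  have key : ∀ n, p * Phi (u n) ≤ κ * Psi (u n) + |ε n| * ‖u n‖ := by
    intro n
    have h1 := h n ((1 + r) • u n) (smul_mem_K (by linarith) (hK n))
    obtain ⟨M, hM⟩ := exists_bound_of_mem_K (hK n)
    have e : u n - (1 + r) • u n = (-r) • u n := by
      rw [add_smul, one_smul, neg_smul]; abel
    rw [e, map_smul, fderiv_Phi_self (hK n).1 hM, norm_smul, norm_neg, Real.norm_eq_abs,
      abs_of_pos hr, smul_eq_mul] at h1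
    have h2 := Psi_dilation_le hr hrκ hG (u n)
    have h3 : ε n * (r * ‖u n‖) ≤ |ε n| * (r * ‖u n‖) :=
      mul_le_mul_of_nonneg_right (le_abs_self _) (by positivity)
    have h4 : r * (p * Phi (u n)) ≤ r * (κ * Psi (u n) + |ε n| * ‖u n‖) := by linarith
    exact le_of_mul_le_mul_left h4 hr
  -- With `‖u‖ ≤ 3 + (3 + p) Ψ(u) + p A`, this threshold for `|ε n|` makes the error absorb at most
  -- half of `(p - κ) Ψ(u n)`; `P` below is the resulting bound.
  have hη : 0 < (p - κ) / (2 * (3 + p)) := div_pos (by linarith) (by linarith)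
  have hε' := hε.abs
  rw [abs_zero] at hε'
  set A := |c| + 1
  have hA : 0 ≤ A := by positivity
  set P := 2 * (p * A + (3 + p * A)) / (p - κ)
  refine ⟨max P (3 + (3 + p) * P + p * A), ?_⟩
  filter_upwards [(tendsto_order.1 hε').2 _ hη, (tendsto_order.1 hε').2 1 one_pos,
    (tendsto_order.1 hc.abs).2 A (by simp [A])] with n hn1 hn2 hn3
  have hPsi := Psi_nonneg (u n)
  have h1 := abs_lt.1 hn3
  have hnorm : ‖u n‖ ≤ 3 + (3 + p) * Psi (u n) + p * A := by
    have := V.norm_le hp2 (u n)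
    nlinarith
  have h2 : |ε n| * ‖u n‖ ≤ (p - κ) / 2 * Psi (u n) + (3 + p * A) := by
    have h3 : |ε n| * ‖u n‖ ≤ |ε n| * (3 + (3 + p) * Psi (u n) + p * A) := by gcongr
    have h4 : |ε n| * ((3 + p) * Psi (u n)) ≤
        (p - κ) / (2 * (3 + p)) * ((3 + p) * Psi (u n)) := by gcongr
    have h5 : (p - κ) / (2 * (3 + p)) * ((3 + p) * Psi (u n)) = (p - κ) / 2 * Psi (u n) := by
      field_simp
    have h6 : |ε n| * (3 + p * A) ≤ 1 * (3 + p * A) := by gcongr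
    linarith
  have h3 := key n
  have hP : Psi (u n) ≤ P := by
    rw [le_div_iff₀ (by linarith)]
    nlinarith
  refine ⟨hP.trans (le_max_left _ _), le_max_of_le_right (hnorm.trans ?_)⟩
  gcongr

/-- Bounded Palais–Smale sequences in the cone are relatively compact. -/
lemma exists_subseq_of_bounded [Nontrivial (E N)] (hs : 0 < s) {u : ℕ → V N s p Y} {ε : ℕ → ℝ}
    {C : ℝ} (hK : ∀ n, u n ∈ K N s p Y) (hε : Tendsto ε atTop (𝓝 0))
    (hPsi : ∀ n, Psi (u n) ≤ C) (hnorm : ∀ n, ‖u n‖ ≤ C)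
    (h : ∀ n, ∀ v ∈ K N s p Y, Psi (u n) ≤
      Psi v + (fderiv ℝ (Phi : V N s p Y → ℝ) (u n) (u n - v) + ε n * ‖u n - v‖)) :
    ∃ (φ : ℕ → ℕ) (a : V N s p Y), StrictMono φ ∧
      Tendsto (fun k => u (φ k)) atTop (𝓝 a) := by
  have hp2 := hp.out
  have hC : 0 ≤ C := (Psi_nonneg (u 0)).trans (hPsi 0)
  choose f hf hf0 hfe using fun n => mem_K_iff.1 (hK n)
  have hmod : ∀ n, modular s Y (fun x : E N => f n ‖x‖) ≤ ENNReal.ofReal (2 * C) := by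
    intro n
    rw [← modular_congr (hfe n), ← ENNReal.ofReal_toReal (u n).modular_lt_top.ne]
    exact ENNReal.ofReal_le_ofReal (by linarith [modular_toReal_le_Psi (u n), hPsi n])
  have hsq : ∀ n, ∫ x in B₁ N, |f n ‖x‖| ^ 2 ≤ 2 * C := by
    intro n
    have e : ∫ x in B₁ N, |f n ‖x‖| ^ 2 = ∫ x in B₁ N, |(u n).fn x| ^ 2 := by
      apply integral_congr_ae
      filter_upwards [ae_restrict_of_ae (hfe n)] with x hx
      rw [hx]
    rw [e]
    linarith [integral_sq_le_Psi (u n), hPsi n]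
  -- The radial bound is available from radius `1` on; monotonicity carries it to smaller radii.
  choose M hM using fun r : ℝ =>
    exists_radial_bound (N := N) hs Y (2 * C) (max r 1) (le_max_right _ _)
  have hfM : ∀ n r, f n r ≤ M r := fun n r => (hf n (le_max_left r 1)).trans
    (hM r (f n) (hf n) (hf0 n)
      ((memLp_congr_ae (ae_restrict_of_ae (hfe n))).1 (u n).memLp_two) (hsq n) (hmod n))
  obtain ⟨φ, g, hφ, hg, hg0, hlim⟩ := exists_subseq_tendsto_of_monotone hf hf0 hfM
  have hfmeas : ∀ n, Measurable fun x : E N => f n ‖x‖ := fun n =>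
    (hf n).measurable.comp measurable_norm
  have hae : ∀ᵐ x ∂(volume : Measure (E N)),
      Tendsto (fun k => f (φ k) ‖x‖) atTop (𝓝 (g ‖x‖)) := by
    filter_upwards [ae_continuousAt_norm (N := N) hg] with x hx using hlim _ hx
  have hgmod : modular s Y (fun x : E N => g ‖x‖) < ∞ :=
    (modular_le_of_tendsto_ae (fun k => hfmeas (φ k)) hae fun k => hmod (φ k)).trans_lt
      ENNReal.ofReal_lt_top
  obtain ⟨a, haK, ha⟩ := exists_mem_K (p := p) hg hg0 hgmod
  refine ⟨φ, a, hφ, ?_⟩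
  set w : ℕ → V N s p Y := fun k => u (φ k)
  have hwae : ∀ᵐ x ∂(volume : Measure (E N)), Tendsto (fun k => (w k).fn x) atTop (𝓝 (a.fn x)) := by
    filter_upwards [hae, ae_all_iff.2 fun k => hfe (φ k), ha] with x h1 h2 h3
    rw [h3]
    exact h1.congr fun k => (h2 k).symm
  have hB : MeasurableSet (B₁ N) := Metric.isOpen_ball.measurableSet
  have hw : ∀ k, ∀ᵐ x ∂volume.restrict (B₁ N), 0 ≤ (w k).fn x ∧ (w k).fn x ≤ M 1 := by
    intro k
    filter_upwards [ae_restrict_of_ae (hfe (φ k)), ae_restrict_mem hB] with x h1 hx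
    simp only [w, h1]
    exact ⟨hf0 _ _, (hf _ (mem_ball_zero_iff.1 hx).le).trans (hfM _ 1)⟩
  have haB : ∀ᵐ x ∂volume.restrict (B₁ N), 0 ≤ a.fn x ∧ a.fn x ≤ g 1 := by
    filter_upwards [ae_restrict_of_ae ha, ae_restrict_mem hB] with x h1 hx
    rw [h1]
    exact ⟨hg0 _, hg (mem_ball_zero_iff.1 hx).le⟩
  have hdiff : ∀ k, ∀ᵐ x ∂volume.restrict (B₁ N), |(w k - a).fn x| ≤ M 1 + g 1 := by
    intro k
    filter_upwards [hw k, haB, ae_restrict_of_ae (V.fn_sub (w k) a)] with x h1 h2 h3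
    rw [h3, abs_le]
    constructor <;> linarith
  have hdiff0 : ∀ᵐ x ∂volume.restrict (B₁ N),
      Tendsto (fun k => (w k - a).fn x) atTop (𝓝 0) := by
    filter_upwards [ae_restrict_of_ae hwae,
      ae_restrict_of_ae (ae_all_iff.2 fun k => V.fn_sub (w k) a)] with x h1 h2
    have := h1.sub_const (a.fn x)
    rw [sub_self] at this
    exact this.congr fun k => (h2 k).symm
  have hLp : Tendsto (fun k => (eLpNorm (w k - a).fn (ENNReal.ofReal p)
      (volume.restrict (B₁ N))).toReal) atTop (𝓝 0) :=
    tendsto_eLpNorm_zero_of_bounded (by linarith) (fun k => (w k - a).memLp) hdiff hdiff0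
  have hL2 : Tendsto (fun k => (eLpNorm (w k - a).fn 2
      (volume.restrict (B₁ N))).toReal) atTop (𝓝 0) := by
    have e : ENNReal.ofReal 2 = 2 := by simp
    have := tendsto_eLpNorm_zero_of_bounded (q := 2) zero_lt_two
      (fun k => by rw [e]; exact (w k - a).memLp_two) hdiff hdiff0
    rwa [e] at this
  have hsqlim : Tendsto (fun k => ∫ x in B₁ N, |(w k).fn x| ^ 2) atTop
      (𝓝 (∫ x in B₁ N, |a.fn x| ^ 2)) := by
    apply tendsto_integral_of_dominated_convergence (fun _ => M 1 ^ 2)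
      (fun k => ((w k).measurable_fn.abs.pow_const 2).aestronglyMeasurable) (integrable_const _)
    · intro k
      filter_upwards [hw k] with x hx
      rw [Real.norm_eq_abs, abs_of_nonneg (by positivity), abs_of_nonneg hx.1]
      exact pow_le_pow_left₀ hx.1 hx.2 2
    · filter_upwards [ae_restrict_of_ae hwae] with x hx using hx.abs.pow 2
  have hderiv : Tendsto (fun k => fderiv ℝ (Phi : V N s p Y → ℝ) (w k) (w k - a)) atTop
      (𝓝 0) := by
    have h1 := hL2.const_mul (M 1 ^ (p - 1) * (1 + (volume (B₁ N)).toReal))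
    rw [mul_zero] at h1
    refine squeeze_zero_norm (fun k => ?_) h1
    have h2 : ∀ᵐ x ∂volume.restrict (B₁ N), (w k).fn x ≤ M 1 := by
      filter_upwards [hw k] with x hx using hx.2
    rw [fderiv_Phi (hK (φ k)).1 h2, Real.norm_eq_abs, mul_assoc]
    have hM1 : 0 ≤ M 1 := (hf0 0 1).trans (hfM 0 1)
    exact (V.abs_integral_rpow_mul_le (hK (φ k)).1 h2 _).trans
      (mul_le_mul_of_nonneg_left (w k - a).integral_abs_le (by positivity))
  have hεlim : Tendsto (fun k => ε (φ k) * ‖w k - a‖) atTop (𝓝 0) := by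
    have h1 := ((hε.comp hφ.tendsto_atTop).abs).mul_const (C + ‖a‖)
    rw [abs_zero, zero_mul] at h1
    refine squeeze_zero_norm (fun k => ?_) h1
    rw [norm_mul, norm_norm, Real.norm_eq_abs]
    have h2 : ‖w k - a‖ ≤ C + ‖a‖ :=
      (norm_sub_le _ _).trans (add_le_add (hnorm (φ k)) le_rfl)
    exact mul_le_mul_of_nonneg_left h2 (abs_nonneg _)
  have hδ := ((((hsqlim.const_sub (∫ x in B₁ N, |a.fn x| ^ 2)).const_mul (1 / 2)).add
    hderiv).add hεlim)
  rw [sub_self, mul_zero, add_zero, add_zero] at hδ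
  have hδ' := ENNReal.tendsto_ofReal hδ
  rw [ENNReal.ofReal_zero] at hδ'
  -- The variational inequality with `v = a`, solved for `ρ(w k)`; the added term tends to `0` by
  -- `hδ'`.
  have hρ : ∀ k, modular s Y (w k).fn ≤ modular s Y a.fn + ENNReal.ofReal
      (1 / 2 * ((∫ x in B₁ N, |a.fn x| ^ 2) - ∫ x in B₁ N, |(w k).fn x| ^ 2) +
        fderiv ℝ (Phi : V N s p Y → ℝ) (w k) (w k - a) + ε (φ k) * ‖w k - a‖) := by
    intro k
    have h1 := h (φ k) a haK
    unfold Psi at h1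
    rw [← ENNReal.ofReal_toReal (w k).modular_lt_top.ne,
      ← ENNReal.ofReal_toReal a.modular_lt_top.ne]
    refine le_trans (ENNReal.ofReal_le_ofReal ?_) ENNReal.ofReal_add_le
    simp only [w]
    linarith
  have hlux : Tendsto (fun k => luxemburg s Y (w k - a).fn) atTop (𝓝 0) := by
    have h1 := tendsto_luxemburg_zero (tendsto_modular_sub (fun k => (w k).measurable_fn)
      a.measurable_fn hwae a.modular_lt_top hδ' hρ)
    exact h1.congr fun k => (luxemburg_congr (V.fn_sub (w k) a)).symm
  rw [tendsto_iff_norm_sub_tendsto_zero]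
  have := (hL2.add hlux).add hLp
  rw [add_zero, add_zero] at this
  exact this

end Compactness

end FracOrlicz


/-! ### The Palais–Smale condition -/

theorem lemma3p4 (N : ℕ) (hN : 2 ≤ N) (s p : ℝ) (hs0 : 0 < s) (hs1 : s < 1)
    [hp : Fact (2 < p)] (Y : FracOrlicz.YoungFunction) [hY : Y.Growth]
    (hconv : ConvexOn ℝ (Set.Ici 0) (fun t => Y.G (Real.sqrt t)))
    (hqm : 2 ≤ Y.qMinus) (hqp : Y.qPlus < p) :
    FracOrlicz.PalaisSmale
      (FracOrlicz.PsiK : FracOrlicz.V N s p Y → EReal)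
      (FracOrlicz.Phi : FracOrlicz.V N s p Y → ℝ) := by
  open FracOrlicz in
  intro c u ε hI hε h
  have hnt : Nontrivial (E N) := by
    have : Nonempty (Fin N) := ⟨⟨0, by omega⟩⟩
    infer_instance
  have hPsiK : ∀ v ∈ K N s p Y, PsiK v = (Psi v : EReal) := fun v hv => if_pos hv
  -- The test element `0` lies in the cone and makes the right-hand side finite, which excludes
  -- `PsiK (u n) = ⊤`.
  have hK : ∀ n, u n ∈ K N s p Y := by
    intro n
    by_contra hn
    have h1 := h n 0
    rw [hPsiK 0 zero_mem_K, PsiK, if_neg hn, ← EReal.coe_add] at h1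
    exact EReal.coe_ne_top _ (top_le_iff.1 h1)
  have hreal : ∀ n, ∀ v ∈ K N s p Y, Psi (u n) ≤
      Psi v + (fderiv ℝ (Phi : V N s p Y → ℝ) (u n) (u n - v) + ε n * ‖u n - v‖) := by
    intro n v hv
    have h1 := h n v
    rw [hPsiK v hv, hPsiK _ (hK n), ← EReal.coe_add] at h1
    exact EReal.coe_le_coe_iff.1 h1
  have hc : Tendsto (fun n => Psi (u n) - Phi (u n)) atTop (𝓝 c) := by
    rw [← EReal.tendsto_coe]
    refine hI.congr fun n => ?_
    rw [hPsiK _ (hK n), EReal.coe_sub]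
  obtain ⟨C, hC⟩ := eventually_bounded hqm hqp hK hc hε hreal
  -- The bounds hold only from some index on, so the compactness argument runs on the shifted
  -- sequence.
  obtain ⟨n₀, hn₀⟩ := eventually_atTop.1 hC
  have hshift : Tendsto (fun n => n + n₀) atTop atTop := tendsto_add_atTop_nat n₀
  obtain ⟨φ, a, hφ, ha⟩ := exists_subseq_of_bounded hs0 (u := fun n => u (n + n₀))
    (fun n => hK _) (hε.comp hshift) (fun n => (hn₀ _ (Nat.le_add_left _ _)).1)
    (fun n => (hn₀ _ (Nat.le_add_left _ _)).2) (fun n => hreal _)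
  exact ⟨fun k => φ k + n₀, a, fun i j hij => Nat.add_lt_add_right (hφ hij) n₀, ha⟩
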